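/- Let $(X,d)$ be a strongly discrete metric space of bounded geometry, i.e. $\{d(x,y):x,y\in X\}$ is a discrete subset of $\mathbb R$ and $\sup_{x\in X}|\{y: d(x,y)\le r\}|<\infty$ for every $r>0$. Let $\beta X$ be the Stone–Čech compactification of the discrete space $X$ and $\partial_\beta X=\beta X\setminus X$. For $R>0$ put $E_R=\{(x,y)\in X\times X: d(x,y)\le R\}$. The coarse groupoid $G(X)=\bigcup_{R>0}\overline{E_R}\subseteq\beta(X\times X)$ carries the subspace topology; its range and source maps $r,s:G(X)\to\beta X$ extend the two coordinate projections, and through the injection $(r,s):G(X)\to\beta X\times\beta X$ it is a subgroupoid of the pair groupoid of $\beta X$. A set $Y\subseteq\beta X$ is invariant if $r^{-1}(Y)=s^{-1}(Y)$; then $G(X)_Y=r^{-1}(Y)\cap s^{-1}(Y)$ is a groupoid with unit space $Y$. A locally compact Hausdorff étale groupoid $\mathcal G$ is amenable if for all $\varepsilon>0$ and compact $K\subseteq\mathcal G$ there is $f\in C_c(\mathcal G)$ with values in $[0,1]$ such that for all $\gamma\in K$ $$\sum_{s(\alpha)=r(\gamma)}f(\alpha)=1\quad\text{and}\quad\sum_{s(\alpha)=r(\gamma)}|f(\alpha)-f(\alpha\gamma)|<\varepsilon.$$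 Let $U\subseteq\beta X$ be an invariant open set and $U^c=\partial_\beta X\setminus U$. Then the following are equivalent. (1) $X$ has partial Property A towards $U^c$: the groupoid $G(X)_{U^c}$ is amenable. (2) $X$ has the partial operator norm localisation property towards $U^c$: for $\mathcal H$ a separable infinite-dimensional complex Hilbert space, there is $c\in(0,1]$ such that for every $R>0$ there are $S>0$ and $D\subseteq X$ with $\overline D\supseteq U^c$ (closure in $\beta X$) such that for every non-zero positive locally finite Borel measure $\nu$ on $X$ with $\mathrm{supp}(\nu)\subseteq D$ and every bounded operator $a$ on $L^2(X,\nu)\otimes\mathcal H\cong L^2(X,\nu;\mathcal H)$ of propagation at most $R$ (i.e. $\chi_{\{x\}}a\chi_{\{y\}}=0$ whenever $d(x,y)>R$), there is a non-zero $\zeta\in L^2(X,\nu)\otimes\mathcal H$ with $\mathrm{diam}(\mathrm{supp}(\zeta))\le S$ and $c\|a\|\,\|\zeta\|\le\|a\zeta\|$. -/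

import Mathlib

open Set Filter Topology MeasureTheory
open scoped ENNReal

namespace CoarseGeom

universe u v

/-! ### Groupoids and amenability -/

/-- A groupoid with object (unit) set `B` and set of morphisms `G`; `mul g h` is the product `gh`,
defined when the source of `g` is the range of `h`. -/
structure ArrowGroupoid (B : Type u) (G : Type v) where
  r : G → B
  s : G → B
  one : B → G
  inv : G → G
  mul : (g h : G) → s g = r h → G
  r_one : ∀ b, r (one b) = b
  s_one : ∀ b, s (one b) = b
  r_inv : ∀ g, r (inv g) = s g
  s_inv : ∀ g, s (inv g) = r g
  r_mul : ∀ g h e, r (mul g h e) = r g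
  s_mul : ∀ g h e, s (mul g h e) = s h
  one_mul : ∀ g, mul (one (r g)) g (s_one (r g)) = g
  mul_one : ∀ g, mul g (one (s g)) (r_one (s g)).symm = g
  inv_mul : ∀ g, mul (inv g) g (s_inv g) = one (s g)
  mul_inv : ∀ g, mul g (inv g) (r_inv g).symm = one (r g)
  mul_assoc : ∀ g h k (e₁ : s g = r h) (e₂ : s h = r k),
    mul (mul g h e₁) k ((s_mul g h e₁).trans e₂) = mul g (mul h k e₂) (e₁.trans (r_mul h k e₂).symm)

namespace ArrowGroupoid

variable {B : Type u} {G : Type v}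

/-- A set `Y` of units is invariant if `r⁻¹(Y) = s⁻¹(Y)`. -/
def IsInvariant (𝒢 : ArrowGroupoid B G) (Y : Set B) : Prop :=
  𝒢.r ⁻¹' Y = 𝒢.s ⁻¹' Y

/-- The reduction `r⁻¹(Y) ∩ s⁻¹(Y)` of a groupoid by a set `Y` of units. -/
def reduction (𝒢 : ArrowGroupoid B G) (Y : Set B) :
    ArrowGroupoid Y {g : G // 𝒢.r g ∈ Y ∧ 𝒢.s g ∈ Y} where
  r g := ⟨𝒢.r g.1, g.2.1⟩
  s g := ⟨𝒢.s g.1, g.2.2⟩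
  one b := ⟨𝒢.one b.1, by rw [𝒢.r_one]; exact b.2, by rw [𝒢.s_one]; exact b.2⟩
  inv g := ⟨𝒢.inv g.1, by rw [𝒢.r_inv]; exact g.2.2, by rw [𝒢.s_inv]; exact g.2.1⟩
  mul g h e := ⟨𝒢.mul g.1 h.1 (congrArg Subtype.val e),
    by rw [𝒢.r_mul]; exact g.2.1, by rw [𝒢.s_mul]; exact h.2.2⟩
  r_one b := Subtype.ext (𝒢.r_one b.1)
  s_one b := Subtype.ext (𝒢.s_one b.1)
  r_inv g := Subtype.ext (𝒢.r_inv g.1)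
  s_inv g := Subtype.ext (𝒢.s_inv g.1)
  r_mul g h e := Subtype.ext (𝒢.r_mul g.1 h.1 (congrArg Subtype.val e))
  s_mul g h e := Subtype.ext (𝒢.s_mul g.1 h.1 (congrArg Subtype.val e))
  one_mul g := Subtype.ext (𝒢.one_mul g.1)
  mul_one g := Subtype.ext (𝒢.mul_one g.1)
  inv_mul g := Subtype.ext (𝒢.inv_mul g.1)
  mul_inv g := Subtype.ext (𝒢.mul_inv g.1)
  mul_assoc g h k e₁ e₂ := Subtype.ext
    (𝒢.mul_assoc g.1 h.1 k.1 (congrArg Subtype.val e₁) (congrArg Subtype.val e₂))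

/-- (Topological) amenability of a locally compact Hausdorff étale groupoid: for every `ε > 0` and
compact `K ⊆ G` there is `f ∈ C_c(G)` with values in `[0,1]` such that for all `γ ∈ K`,
`∑ f(α) = 1` and `∑ |f(α) - f(αγ)| < ε`, both sums being over the `α` with source `r(γ)`. -/
def IsAmenable (𝒢 : ArrowGroupoid B G) [TopologicalSpace G] : Prop :=
  ∀ ε : ℝ, 0 < ε → ∀ K : Set G, IsCompact K →
    ∃ f : G → ℝ, Continuous f ∧ HasCompactSupport f ∧ (∀ g, f g ∈ Set.Icc (0 : ℝ) 1) ∧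
      ∀ γ ∈ K,
        HasSum (fun α : {α : G // 𝒢.s α = 𝒢.r γ} => f α.1) 1 ∧
        ∃ t < ε, HasSum
          (fun α : {α : G // 𝒢.s α = 𝒢.r γ} => |f α.1 - f (𝒢.mul α.1 γ α.2)|) t

end ArrowGroupoid

/-! ### Spaces, the Stone-Čech compactification, the coarse groupoid

The Stone-Čech compactification `βX` of the discrete space `X` is `Ultrafilter X`, in which
`x : X` is identified with the principal ultrafilter `pure x`. -/

/-- Strongly discrete metric spaces of bounded geometry. -/
structure IsSpace (X : Type u) [MetricSpace X] : Prop where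
  stronglyDiscrete : IsDiscrete (Set.range fun p : X × X => dist p.1 p.2)
  boundedGeometry : ∀ r : ℝ, 0 < r → ∃ N : ℕ, ∀ x : X, (Metric.closedBall x r).encard ≤ N

/-- The Stone-Čech boundary `βX ∖ X`. -/
def boundary (X : Type u) : Set (Ultrafilter X) :=
  (Set.range (pure : X → Ultrafilter X))ᶜ

/-- The closure in `βX` of a subset of `X`. -/
def betaClosure {X : Type u} (D : Set X) : Set (Ultrafilter X) :=
  closure ((pure : X → Ultrafilter X) '' D)

theorem mem_betaClosure {X : Type u} {D : Set X} {ω : Ultrafilter X} :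
    ω ∈ betaClosure D ↔ D ∈ ω := by
  unfold betaClosure
  rw [ultrafilterBasis_is_basis.mem_closure_iff]
  constructor
  · intro h
    by_contra hD
    have h2 : Dᶜ ∈ ω := Ultrafilter.compl_mem_iff_notMem.2 hD
    obtain ⟨q, hq, x, hx, rfl⟩ := h {u | Dᶜ ∈ u} ⟨Dᶜ, rfl⟩ h2
    exact (Ultrafilter.mem_pure.1 hq) hx
  · rintro h _ ⟨A, rfl⟩ hA
    obtain ⟨x, hx, hx'⟩ := ω.nonempty_of_mem (Filter.inter_mem h hA)
    exact ⟨pure x, Ultrafilter.mem_pure.2 hx', x, hx, rfl⟩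

variable (X : Type u) [MetricSpace X]

/-- The entourage `E_R = {(x,y) : d(x,y) ≤ R}`. -/
def entourage (R : ℝ) : Set (X × X) := {p | dist p.1 p.2 ≤ R}

/-- The union over `R > 0` of the closures of `E_R` in `β(X × X)`. -/
abbrev EntourageUnion : Type u :=
  {p : Ultrafilter (X × X) // ∃ R : ℝ, 0 < R ∧ p ∈ betaClosure (entourage X R)}

/-- The set of arrows of the coarse groupoid `G(X)`, realised inside `βX × βX` as the image of the
union of the closures of the `E_R` in `β(X × X)` under the extensions `(r,s)` of the two
coordinate projections. -/
def CoarseArrow : Type u :=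
  {q : Ultrafilter X × Ultrafilter X //
    ∃ p : EntourageUnion X, p.1.map Prod.fst = q.1 ∧ p.1.map Prod.snd = q.2}

/-- The map `(r,s)`; it is a bijection when `X` has bounded geometry. -/
def toCoarseArrow (p : EntourageUnion X) : CoarseArrow X :=
  ⟨(p.1.map Prod.fst, p.1.map Prod.snd), p, rfl, rfl⟩

/-- The topology of `G(X)` is that of the subspace `EntourageUnion X` of `β(X × X)`, carried over
along the bijection `(r,s)`. -/
instance : TopologicalSpace (CoarseArrow X) :=
  TopologicalSpace.coinduced (toCoarseArrow X) inferInstance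

variable {X}

/-- `(a,b)` lies in the image of the closure of `E_R` iff every `A ∈ a`, `B ∈ b` contain points at
distance at most `R`. -/
theorem exists_entourage_iff {R : ℝ} {a b : Ultrafilter X} :
    (∃ p : Ultrafilter (X × X), p ∈ betaClosure (entourage X R) ∧
      p.map Prod.fst = a ∧ p.map Prod.snd = b) ↔
    ∀ A ∈ a, ∀ B ∈ b, ∃ x ∈ A, ∃ y ∈ B, dist x y ≤ R := by
  constructor
  · rintro ⟨p, hp, rfl, rfl⟩ A hA B hB
    rw [mem_betaClosure] at hp
    rw [Ultrafilter.mem_map] at hA hB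
    obtain ⟨z, hz, hz1, hz2⟩ := p.nonempty_of_mem (Filter.inter_mem hp (Filter.inter_mem hA hB))
    exact ⟨z.1, hz1, z.2, hz2, hz⟩
  · intro h
    have hne : ((a : Filter X) ×ˢ (b : Filter X) ⊓ 𝓟 (entourage X R)).NeBot := by
      rw [Filter.inf_principal_neBot_iff]
      intro U hU
      obtain ⟨A, hA, B, hB, hAB⟩ := Filter.mem_prod_iff.1 hU
      obtain ⟨x, hx, y, hy, hxy⟩ := h A hA B hB
      exact ⟨(x, y), hAB ⟨hx, hy⟩, hxy⟩
    refine ⟨Ultrafilter.of ((a : Filter X) ×ˢ (b : Filter X) ⊓ 𝓟 (entourage X R)), ?_, ?_, ?_⟩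
    · rw [mem_betaClosure]
      exact Ultrafilter.of_le _ (Filter.mem_inf_of_right (Filter.mem_principal_self _))
    · refine Ultrafilter.coe_le_coe.1 ?_
      rw [Ultrafilter.coe_map]
      exact (Filter.map_mono ((Ultrafilter.of_le _).trans inf_le_left)).trans Filter.tendsto_fst
    · refine Ultrafilter.coe_le_coe.1 ?_
      rw [Ultrafilter.coe_map]
      exact (Filter.map_mono ((Ultrafilter.of_le _).trans inf_le_left)).trans Filter.tendsto_snd

theorem coarse_iff {a b : Ultrafilter X} :
    (∃ p : EntourageUnion X, p.1.map Prod.fst = a ∧ p.1.map Prod.snd = b) ↔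
    ∃ R : ℝ, 0 < R ∧ ∀ A ∈ a, ∀ B ∈ b, ∃ x ∈ A, ∃ y ∈ B, dist x y ≤ R := by
  constructor
  · rintro ⟨⟨p, R, hR, hp⟩, h1, h2⟩
    exact ⟨R, hR, exists_entourage_iff.1 ⟨p, hp, h1, h2⟩⟩
  · rintro ⟨R, hR, h⟩
    obtain ⟨p, hp, h1, h2⟩ := exists_entourage_iff.2 h
    exact ⟨⟨p, R, hR, hp⟩, h1, h2⟩

theorem coarse_refl (a : Ultrafilter X) :
    ∃ p : EntourageUnion X, p.1.map Prod.fst = a ∧ p.1.map Prod.snd = a := by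
  refine coarse_iff.2 ⟨1, one_pos, fun A hA B hB => ?_⟩
  obtain ⟨x, hx, hx'⟩ := a.nonempty_of_mem (Filter.inter_mem hA hB)
  exact ⟨x, hx, x, hx', by simp⟩

theorem coarse_symm {a b : Ultrafilter X}
    (h : ∃ p : EntourageUnion X, p.1.map Prod.fst = a ∧ p.1.map Prod.snd = b) :
    ∃ p : EntourageUnion X, p.1.map Prod.fst = b ∧ p.1.map Prod.snd = a := by
  obtain ⟨R, hR, h⟩ := coarse_iff.1 h
  refine coarse_iff.2 ⟨R, hR, fun B hB A hA => ?_⟩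
  obtain ⟨x, hx, y, hy, hxy⟩ := h A hA B hB
  exact ⟨y, hy, x, hx, by rwa [dist_comm]⟩

theorem coarse_trans {a b c : Ultrafilter X}
    (h₁ : ∃ p : EntourageUnion X, p.1.map Prod.fst = a ∧ p.1.map Prod.snd = b)
    (h₂ : ∃ p : EntourageUnion X, p.1.map Prod.fst = b ∧ p.1.map Prod.snd = c) :
    ∃ p : EntourageUnion X, p.1.map Prod.fst = a ∧ p.1.map Prod.snd = c := by
  obtain ⟨R, hR, h₁⟩ := coarse_iff.1 h₁
  obtain ⟨S, hS, h₂⟩ := coarse_iff.1 h₂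
  refine coarse_iff.2 ⟨R + S, add_pos hR hS, fun A hA C hC => ?_⟩
  have hN : {y | ∃ x ∈ A, dist x y ≤ R} ∈ b := by
    by_contra hn
    obtain ⟨x, hx, y, hy, hxy⟩ := h₁ A hA _ (Ultrafilter.compl_mem_iff_notMem.2 hn)
    exact hy ⟨x, hx, hxy⟩
  obtain ⟨y, ⟨x, hx, hxy⟩, z, hz, hyz⟩ := h₂ _ hN C hC
  exact ⟨x, hx, z, hz, (dist_triangle x y z).trans (add_le_add hxy hyz)⟩

variable (X)

/-- The coarse groupoid `G(X)` with unit space `βX`, as a subgroupoid of the pair groupoid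
`βX × βX`: `r(a,b) = a`, `s(a,b) = b`, `(a,b)(b,c) = (a,c)`. -/
def coarseGroupoid : ArrowGroupoid (Ultrafilter X) (CoarseArrow X) where
  r g := g.1.1
  s g := g.1.2
  one a := ⟨(a, a), coarse_refl a⟩
  inv g := ⟨(g.1.2, g.1.1), coarse_symm g.2⟩
  mul g h e := ⟨(g.1.1, h.1.2), coarse_trans g.2 (by rw [e]; exact h.2)⟩
  r_one _ := rfl
  s_one _ := rfl
  r_inv _ := rfl
  s_inv _ := rfl
  r_mul _ _ _ := rfl
  s_mul _ _ _ := rfl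
  one_mul _ := rfl
  mul_one _ := rfl
  inv_mul _ := rfl
  mul_inv _ := rfl
  mul_assoc _ _ _ _ _ := rfl

/-- Partial Property A towards a subset `V` of `βX`: the reduction of the coarse groupoid `G(X)` by
`V`, with the subspace topology, is amenable. -/
def HasPartialPropertyA (V : Set (Ultrafilter X)) : Prop :=
  ((coarseGroupoid X).reduction V).IsAmenable

/-! ### The partial operator norm localisation property

`L²(X,ν) ⊗ H` is realised as the space `Lp H 2 ν` of square-integrable `H`-valued functions. -/

section ONL

variable {X} [MeasurableSpace X] {H : Type v} [NormedAddCommGroup H]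

/-- The support of (the class of) a function in `L²(X,ν;H)`, `X` being countable and discrete. -/
def lpSupport {ν : Measure X} (ζ : Lp H 2 ν) : Set X :=
  {x | ν {x} ≠ 0 ∧ ζ x ≠ 0}

variable [InnerProductSpace ℂ H]

/-- The support of an operator `T` on `L²(X,ν;H)`: the pairs `(x,y)` such that the matrix entry
`χ_{x} T χ_{y}` is non-zero. -/
def opSupport {ν : Measure X} (T : Lp H 2 ν →L[ℂ] Lp H 2 ν) : Set (X × X) :=
  {p | ∃ ζ : Lp H 2 ν, lpSupport ζ ⊆ {p.2} ∧ p.1 ∈ lpSupport (T ζ)}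

/-- `T` has propagation at most `R`. -/
def PropagationLE {ν : Measure X} (T : Lp H 2 ν →L[ℂ] Lp H 2 ν) (R : ℝ) : Prop :=
  ∀ p ∈ opSupport T, dist p.1 p.2 ≤ R

end ONL

/-- Partial operator norm localisation property towards a subset `V` of `βX`, with coefficient
Hilbert space `H`. -/
def HasPartialONL [MeasurableSpace X] (H : Type v) [NormedAddCommGroup H] [InnerProductSpace ℂ H]
    (V : Set (Ultrafilter X)) : Prop :=
  ∃ c : ℝ, 0 < c ∧ c ≤ 1 ∧ ∀ R : ℝ, 0 < R → ∃ S : ℝ, 0 < S ∧ ∃ D : Set X, V ⊆ betaClosure D ∧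
    ∀ ν : Measure X, IsLocallyFiniteMeasure ν → ν ≠ 0 → ν.support ⊆ D →
      ∀ a : Lp H 2 ν →L[ℂ] Lp H 2 ν, PropagationLE a R →
        ∃ ζ : Lp H 2 ν, ζ ≠ 0 ∧ Metric.ediam (lpSupport ζ) ≤ ENNReal.ofReal S ∧
          c * ‖a‖ * ‖ζ‖ ≤ ‖a ζ‖

end CoarseGeom

/-! Write V for the boundary minus U; it is closed and a union of orbits. Both directions pass
through families of weights h(x,·) ≥ 0 on X, supported in S-balls, of total mass (almost) 1, which
vary by at most ε in ℓ¹ when x and y are R-close. They need only be controlled for x in a set D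
whose closure contains V.

Groupoid functions and such families correspond because bounded geometry allows a finite colouring
in which each T-ball has at most one point of each colour. Along an ultrafilter colours are
eventually constant, so a sum over balls converges to a sum over a fibre of the groupoid
(`IsSpace.hasSum_fiber`, `Represents.hasSum`, `Represents.hasSum_abs_sub`).

From Property A to localisation: the functions √h(·,z) form an approximate quadratic partition of
unity that nearly commutes with any operator a of propagation R. If a nearly attains its norm at η,
then some piece √h(·,z)η, supported in a ball, also does so up to a constant
(`localization_estimate`).

From localisation to Property A: over a finite F ⊆ D one looks for a sum of rank one kernels of
localised functions that is close to 1 on pairs at distance at most R. If there is none, Hahn–Banach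
separation yields a measure on F and symmetric weights w ≥ 0 of range R, hence a self-adjoint
operator A with ‖A‖ ≥ κ > 1 that does not increase the norm of vectors of small support
(`exists_separating_weights`). Then A^(2^j) has norm ‖A‖^(2^j), while it still does not increase
such vectors. Since c does not depend on the propagation, j can be fixed in advance with c·κ^(2^j) >
1, which contradicts localisation (`not_disjoint_of_localisation`). The kernels so obtained are Gram
kernels, which give families on F (`exists_family_of_kernel`), and compactness passes from finite F
to D (`exists_family_of_finite`). -/

set_option linter.unusedSectionVars false

/-! ### Colourings of bounded geometry spaces and limits along ultrafilters. -/

namespace CoarseGeom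

/-- Greedy colouring of a graph with vertex degrees at most `N`. -/
theorem exists_greedy_coloring {X : Type*} (nb : X → Finset X) {N : ℕ}
    (hN : ∀ x, (nb x).card ≤ N) :
    ∃ col : X → ℕ, (∀ x, col x < N + 1) ∧
      ∀ x y, x ≠ y → y ∈ nb x → x ∈ nb y → col x ≠ col y := by
  classical
  let r : X → X → Prop := WellOrderingRel
  have wf : WellFounded r := IsWellFounded.wf
  -- Recursion along an arbitrary well-order: each point takes the least colour not used by its
  -- earlier neighbours.
  let F : ∀ x, (∀ y, r y x → ℕ) → ℕ := fun x ih =>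
    sInf {n | ∀ y ∈ nb x, ∀ h : r y x, ih y h ≠ n}
  let col : X → ℕ := wf.fix F
  have hcol : ∀ x, col x = sInf {n | ∀ y ∈ nb x, r y x → col y ≠ n} := fun x => wf.fix_eq F x
  have hex : ∀ x, ∃ n < N + 1, ∀ y ∈ nb x, r y x → col y ≠ n := by
    intro x
    obtain ⟨n, hn, hn'⟩ : ∃ n ∈ Finset.range (N + 1), n ∉ (nb x).image col := by
      apply Finset.exists_mem_notMem_of_card_lt_card
      rw [Finset.card_range]
      exact Nat.lt_succ_of_le (Finset.card_image_le.trans (hN x))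
    refine ⟨n, Finset.mem_range.1 hn, fun y hy _ h => hn' ?_⟩
    exact Finset.mem_image.2 ⟨y, hy, h⟩
  have hmem : ∀ x, ∀ y ∈ nb x, r y x → col y ≠ col x := by
    intro x
    obtain ⟨n, -, hn⟩ := hex x
    have := Nat.sInf_mem (s := {n | ∀ y ∈ nb x, r y x → col y ≠ n}) ⟨n, hn⟩
    rw [← hcol x] at this
    exact this
  refine ⟨col, fun x => ?_, fun x y hxy hy hx => ?_⟩
  · obtain ⟨n, hnN, hn⟩ := hex x
    rw [hcol x]
    exact (Nat.sInf_le (by exact hn)).trans_lt hnN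
  · rcases trichotomous_of r x y with h | h | h
    · exact hmem y x hx h
    · exact absurd h hxy
    · exact (hmem x y hy h).symm

variable {X : Type*} [MetricSpace X]

theorem IsSpace.finite_closedBall (hX : IsSpace X) (x : X) (r : ℝ) :
    (Metric.closedBall x r).Finite := by
  obtain ⟨N, hN⟩ := hX.boundedGeometry (max r 1) (by positivity)
  refine Set.Finite.subset ?_ (Metric.closedBall_subset_closedBall (le_max_left r 1))
  exact Set.finite_of_encard_le_coe (hN x)

/-- Closed balls of a space of bounded geometry, as finite sets. -/
noncomputable def IsSpace.cball (hX : IsSpace X) (x : X) (r : ℝ) : Finset X :=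
  (hX.finite_closedBall x r).toFinset

theorem IsSpace.mem_cball (hX : IsSpace X) {x y : X} {r : ℝ} :
    y ∈ hX.cball x r ↔ dist y x ≤ r := by
  simp [IsSpace.cball]

theorem IsSpace.exists_card_cball_le (hX : IsSpace X) (r : ℝ) :
    ∃ N : ℕ, ∀ x, (hX.cball x r).card ≤ N := by
  obtain ⟨N, hN⟩ := hX.boundedGeometry (max r 1) (by positivity)
  refine ⟨N, fun x => ?_⟩
  have h1 : ((hX.cball x r : Finset X) : Set X).encard ≤ N := by
    refine (Set.encard_le_encard ?_).trans (hN x)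
    intro y hy
    have : dist y x ≤ r := hX.mem_cball.1 hy
    exact this.trans (le_max_left r 1)
  rw [Set.encard_coe_eq_coe_finsetCard] at h1
  exact_mod_cast h1

theorem IsSpace.exists_coloring (hX : IsSpace X) (T : ℝ) :
    ∃ (M : ℕ) (col : X → ℕ), (∀ x, col x < M) ∧
      ∀ x y, dist x y ≤ T → col x = col y → x = y := by
  obtain ⟨N, hN⟩ := hX.exists_card_cball_le T
  obtain ⟨col, h1, h2⟩ := exists_greedy_coloring (fun x => hX.cball x T) hN
  refine ⟨N + 1, col, h1, fun x y hxy hc => ?_⟩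
  by_contra hne
  exact h2 x y hne (hX.mem_cball.2 (by rwa [dist_comm])) (hX.mem_cball.2 hxy) hc

theorem IsSpace.countable (hX : IsSpace X) : Countable X := by
  rcases isEmpty_or_nonempty X with h | ⟨⟨x⟩⟩
  · infer_instance
  · rw [← Set.countable_univ_iff, ← Metric.iUnion_closedBall_nat x]
    exact Set.countable_iUnion fun n => (hX.finite_closedBall x n).countable

theorem IsSpace.isOpen_singleton (hX : IsSpace X) (x : X) : IsOpen ({x} : Set X) := by
  have hfin : (Metric.closedBall x 1 \ {x}).Finite := (hX.finite_closedBall x 1).subset sdiff_subset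
  have : ({x} : Set X) = Metric.ball x 1 ∩ (Metric.closedBall x 1 \ {x})ᶜ := by
    ext y
    simp only [mem_singleton_iff, mem_inter_iff, Metric.mem_ball, mem_compl_iff, Set.mem_sdiff,
      Metric.mem_closedBall, not_and, not_not]
    constructor
    · rintro rfl
      simp
    · rintro ⟨h1, h2⟩
      exact h2 h1.le
  rw [this]
  exact Metric.isOpen_ball.inter hfin.isClosed.isOpen_compl

/-- A finite colouring is eventually constant along an ultrafilter. -/
theorem exists_eventually_color_eq {P : Type*} (p : Ultrafilter P) {M : ℕ} {col : P → ℕ}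
    (h : ∀ x, col x < M) : ∃ i < M, ∀ᶠ x in p, col x = i := by
  have : (col ⁻¹' (Finset.range M : Set ℕ)) ∈ p := by
    refine Filter.univ_mem' fun x => ?_
    simp [h x]
  obtain ⟨i, hi, he⟩ := Ultrafilter.eq_pure_of_finite_mem (f := p.map col)
    (Finset.range M).finite_toSet this
  refine ⟨i, by simpa using hi, ?_⟩
  have h2 : ({i} : Set ℕ) ∈ p.map col := by rw [he]; exact Ultrafilter.mem_pure.2 rfl
  exact h2

open Classical in
/-- A point of colour `i` at distance at most `T` from `x`, and `x` itself if there is none. -/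
noncomputable def select (col : X → ℕ) (T : ℝ) (i : ℕ) (x : X) : X :=
  if h : ∃ z, dist z x ≤ T ∧ col z = i then h.choose else x

theorem select_spec {col : X → ℕ} {T : ℝ} {i : ℕ} {x : X} (h : ∃ z, dist z x ≤ T ∧ col z = i) :
    dist (select col T i x) x ≤ T ∧ col (select col T i x) = i := by
  rw [select, dif_pos h]
  exact h.choose_spec

theorem dist_select_le {col : X → ℕ} {T : ℝ} (hT : 0 ≤ T) (i : ℕ) (x : X) :
    dist (select col T i x) x ≤ T := by
  by_cases h : ∃ z, dist z x ≤ T ∧ col z = i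
  · exact (select_spec h).1
  · rw [select, dif_neg h]
    simpa using hT

/-- Two points of a `T`-ball are within `2 * T`, so a colour occurs there at most once and the
choice made by `select` is forced. -/
theorem select_eq {col : X → ℕ} {T : ℝ} (hc : ∀ x y, dist x y ≤ 2 * T → col x = col y → x = y)
    {x z : X} (h : dist z x ≤ T) : select col T (col z) x = z := by
  obtain ⟨h1, h2⟩ := select_spec (i := col z) ⟨z, h, rfl⟩
  refine hc _ _ ?_ h2
  linarith [dist_triangle_right (select col T (col z) x) z x]

theorem ultrafilter_map_congr {P Q : Type*} {p : Ultrafilter P} {f g : P → Q}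
    (h : ∀ᶠ x in p, f x = g x) : p.map f = p.map g :=
  Ultrafilter.coe_injective (Filter.map_congr h)

/-- The colour is eventually some constant `i` along `c`, so near `c` the first coordinate is the
unique point of colour `i` in the `T`-ball around the second one. The function `g` depends on `c`
only, not on `p`. -/
theorem IsSpace.exists_selection (hX : IsSpace X) {T : ℝ} (hT : 0 ≤ T) (c : Ultrafilter X) :
    ∃ g : X → X, (∀ x, dist (g x) x ≤ T) ∧ ∀ p : Ultrafilter (X × X),
      entourage X T ∈ p → p.map Prod.fst = c → ∀ᶠ z : X × X in p, z.1 = g z.2 := by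
  obtain ⟨M, col, hM, hc⟩ := hX.exists_coloring (2 * T)
  obtain ⟨i, -, hi⟩ := exists_eventually_color_eq c hM
  refine ⟨select col T i, dist_select_le hT i, fun p hp hpc => ?_⟩
  have h1 : ∀ᶠ z : X × X in p, col z.1 = i := by
    rw [← hpc] at hi
    exact hi
  have h2 : ∀ᶠ z : X × X in p, dist z.1 z.2 ≤ T := hp
  filter_upwards [h1, h2] with z hz1 hz2
  rw [← hz1, select_eq hc hz2]

theorem entourage_mono {R S : ℝ} (h : R ≤ S) : entourage X R ⊆ entourage X S :=
  fun _ hp => le_trans hp h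

/-- By the selection lemma such an ultrafilter is the image of its second marginal under `x ↦ (g x,
x)`, with `g` determined by the first marginal. -/
theorem IsSpace.eq_of_marginals_eq (hX : IsSpace X) {T : ℝ} (hT : 0 ≤ T)
    {p q : Ultrafilter (X × X)} (hp : entourage X T ∈ p) (hq : entourage X T ∈ q)
    (h1 : p.map Prod.fst = q.map Prod.fst) (h2 : p.map Prod.snd = q.map Prod.snd) : p = q := by
  obtain ⟨g, -, hg⟩ := hX.exists_selection hT (p.map Prod.fst)
  have key : ∀ p' : Ultrafilter (X × X), entourage X T ∈ p' → p'.map Prod.fst = p.map Prod.fst →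
      p' = (p'.map Prod.snd).map (fun x => (g x, x)) := by
    intro p' h h'
    rw [Ultrafilter.map_map]
    conv_lhs => rw [← Ultrafilter.map_id p']
    refine ultrafilter_map_congr ?_
    filter_upwards [hg p' h h'] with z hz
    exact Prod.ext hz rfl
  rw [key p hp rfl, key q hq h1.symm, h2]

theorem IsSpace.injective_toCoarseArrow (hX : IsSpace X) :
    Function.Injective (toCoarseArrow X) := by
  rintro ⟨p, R, hR, hp⟩ ⟨q, S, hS, hq⟩ h
  rw [mem_betaClosure] at hp hq
  have h' := Prod.ext_iff.1 (congrArg Subtype.val h)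
  refine Subtype.ext (hX.eq_of_marginals_eq (T := max R S) (hR.le.trans (le_max_left _ _))
    (mem_of_superset hp (entourage_mono (le_max_left _ _)))
    (mem_of_superset hq (entourage_mono (le_max_right _ _))) h'.1 h'.2)

theorem surjective_toCoarseArrow : Function.Surjective (toCoarseArrow X) := by
  rintro ⟨⟨a, b⟩, p, h1, h2⟩
  exact ⟨p, Subtype.ext (Prod.ext h1 h2)⟩

/-- Limits of sums over balls of fixed radius are sums over the fibre at infinity. -/
theorem IsSpace.hasSum_fiber (hX : IsSpace X) {P : Type*} (p : Ultrafilter P) (π : P → X)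
    {T : ℝ} (hT : 0 ≤ T) (k : X → P → ℝ) (φ : Ultrafilter X → ℝ)
    (hlim : ∀ g : P → X, (∀ᶠ q : P in p, dist (g q) (π q) ≤ T) →
      Tendsto (fun q => k (g q) q) p (𝓝 (φ (p.map g))))
    (hzero : ∀ c, φ c ≠ 0 → ∃ g : P → X, (∀ᶠ q : P in p, dist (g q) (π q) ≤ T) ∧ p.map g = c) :
    ∃ t, HasSum φ t ∧ Tendsto (fun q => ∑ z ∈ hX.cball (π q) T, k z q) p (𝓝 t) := by
  classical
  obtain ⟨M, col, hM, hc⟩ := hX.exists_coloring (2 * T)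
  let A : ℕ → P → Prop := fun i q => ∃ z, dist z (π q) ≤ T ∧ col z = i
  -- The colours present in almost every ball. They index the points of the fibre at which `φ` can
  -- be non-zero: colour `i` gives the limit of `g i`, and distinct colours give distinct limits.
  let I : Finset ℕ := (Finset.range M).filter fun i => ∀ᶠ q in p, A i q
  let g : ℕ → P → X := fun i q => select col T i (π q)
  have hg : ∀ i q, dist (g i q) (π q) ≤ T := fun i q => dist_select_le hT i _
  have hcolg : ∀ i ∈ I, ∀ᶠ q in p, col (g i q) = i := by
    intro i hi
    filter_upwards [(Finset.mem_filter.1 hi).2] with q hq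
    exact (select_spec hq).2
  have hinj : Set.InjOn (fun i => p.map (g i)) (I : Set ℕ) := by
    intro i hi j hj hij
    have h1 : {x | col x = i} ∈ p.map (g i) := hcolg i hi
    have h2 : {x | col x = j} ∈ p.map (g j) := hcolg j hj
    have hij' : p.map (g i) = p.map (g j) := hij
    rw [hij'] at h1
    obtain ⟨x, hx1, hx2⟩ := Ultrafilter.nonempty_of_mem (Filter.inter_mem h1 h2)
    exact hx1.symm.trans hx2
  have hsupp : ∀ c ∉ I.image (fun i => p.map (g i)), φ c = 0 := by
    intro c hcI
    by_contra hne
    obtain ⟨f, hf, rfl⟩ := hzero c hne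
    obtain ⟨i, hi, hi'⟩ := exists_eventually_color_eq p (col := fun q => col (f q)) fun q => hM _
    apply hcI
    refine Finset.mem_image.2 ⟨i, Finset.mem_filter.2 ⟨Finset.mem_range.2 hi, ?_⟩, ?_⟩
    · filter_upwards [hf, hi'] with q h1 h2
      exact ⟨f q, h1, h2⟩
    · refine ultrafilter_map_congr ?_
      filter_upwards [hf, hi'] with q h1 h2
      change select col T i (π q) = f q
      rw [← h2, select_eq hc h1]
  refine ⟨∑ i ∈ I, φ (p.map (g i)), ?_, ?_⟩
  · rw [← Finset.sum_image (f := φ) hinj]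
    exact hasSum_sum_of_ne_finset_zero hsupp
  · have h1 : Tendsto (fun q => ∑ i ∈ I, k (g i q) q) p (𝓝 (∑ i ∈ I, φ (p.map (g i)))) :=
      tendsto_finsetSum _ fun i _ => hlim (g i) (Eventually.of_forall fun q => hg i q)
    refine h1.congr' ?_
    -- As `p` is an ultrafilter, a colour outside `I` is absent from almost every ball. Hence `col`
    -- eventually maps the ball bijectively onto `I`.
    have h2 : ∀ᶠ q in p, ∀ i ∈ Finset.range M, i ∉ I → ¬ A i q := by
      rw [Filter.eventually_all_finset]
      intro i hi
      by_cases h : i ∈ I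
      · simp [h]
      · have : ¬ ∀ᶠ q in p, A i q := fun h' => h (Finset.mem_filter.2 ⟨hi, h'⟩)
        filter_upwards [Ultrafilter.eventually_not.2 this] with q hq _
        exact hq
    have h3 : ∀ᶠ q in p, ∀ i ∈ I, A i q := by
      rw [Filter.eventually_all_finset]
      intro i hi
      exact (Finset.mem_filter.1 hi).2
    filter_upwards [h2, h3] with q hq2 hq3
    refine Finset.sum_nbij' (fun i => g i q) col ?_ ?_ ?_ ?_ ?_
    · intro i _
      exact hX.mem_cball.2 (hg i q)
    · intro z hz
      by_contra hn
      exact hq2 _ (Finset.mem_range.2 (hM z)) hn ⟨z, hX.mem_cball.1 hz, rfl⟩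
    · intro i hi
      exact (select_spec (hq3 i hi)).2
    · intro z hz
      exact select_eq hc (hX.mem_cball.1 hz)
    · intro i _
      rfl

end CoarseGeom

/-! ### Topology of the coarse groupoid; its functions as limits of functions on `X × X`. -/

namespace CoarseGeom

theorem continuous_ultrafilter_map {P Q : Type*} (f : P → Q) :
    Continuous (Ultrafilter.map f : Ultrafilter P → Ultrafilter Q) := by
  refine continuous_generateFrom_iff.2 ?_
  rintro _ ⟨s, rfl⟩
  exact ultrafilter_isOpen_basic (f ⁻¹' s)

variable {X : Type*} [MetricSpace X]

/-- The arrows of the coarse groupoid lying over the closure of `E_R`. -/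
def arrowBall (X : Type*) [MetricSpace X] (R : ℝ) : Set (CoarseArrow X) :=
  toCoarseArrow X '' {p | entourage X R ∈ p.1}

theorem continuous_toCoarseArrow : Continuous (toCoarseArrow X) := continuous_coinduced_rng

theorem arrowBall_mono {R S : ℝ} (h : R ≤ S) : arrowBall X R ⊆ arrowBall X S :=
  Set.image_mono fun _ hp => mem_of_superset hp (entourage_mono h)

theorem mem_arrowBall {R : ℝ} {g : CoarseArrow X} :
    g ∈ arrowBall X R ↔
      ∃ p : Ultrafilter (X × X), entourage X R ∈ p ∧ p.map Prod.fst = g.1.1 ∧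
        p.map Prod.snd = g.1.2 := by
  constructor
  · rintro ⟨p, hp, rfl⟩
    exact ⟨p.1, hp, rfl, rfl⟩
  · rintro ⟨p, hp, h1, h2⟩
    -- `EntourageUnion` demands a positive radius, and `R` need not be positive.
    exact ⟨⟨p, max R 1, by positivity,
      mem_betaClosure.2 (mem_of_superset hp (entourage_mono (le_max_left _ _)))⟩, hp,
      Subtype.ext (Prod.ext h1 h2)⟩

theorem exists_mem_arrowBall (g : CoarseArrow X) : ∃ R, 0 < R ∧ g ∈ arrowBall X R := by
  obtain ⟨⟨p, R, hR, hp⟩, h1, h2⟩ := g.2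
  exact ⟨R, hR, mem_arrowBall.2 ⟨p, mem_betaClosure.1 hp, h1, h2⟩⟩

theorem IsSpace.isClopen_arrowBall (hX : IsSpace X) (R : ℝ) : IsClopen (arrowBall X R) := by
  have h : toCoarseArrow X ⁻¹' arrowBall X R = {p | entourage X R ∈ p.1} :=
    Set.preimage_image_eq _ hX.injective_toCoarseArrow
  constructor
  · rw [← isOpen_compl_iff]
    refine isOpen_coinduced.2 ?_
    rw [Set.preimage_compl, h, isOpen_compl_iff]
    exact (ultrafilter_isClosed_basic _).preimage continuous_subtype_val
  · refine isOpen_coinduced.2 ?_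
    rw [h]
    exact (ultrafilter_isOpen_basic _).preimage continuous_subtype_val

/-- The arrows of the reduction of the coarse groupoid by `V`. -/
abbrev RedArrow (V : Set (Ultrafilter X)) : Type _ :=
  {g : CoarseArrow X // (coarseGroupoid X).r g ∈ V ∧ (coarseGroupoid X).s g ∈ V}

variable {V : Set (Ultrafilter X)}

theorem isCompact_redArrowBall (hV : IsClosed V) {R : ℝ} (hR : 0 < R) :
    IsCompact {g : RedArrow V | g.1 ∈ arrowBall X R} := by
  have hind : Topology.IsInducing (Subtype.val : RedArrow V → CoarseArrow X) := ⟨rfl⟩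
  rw [hind.isCompact_iff]
  let Z : Set (Ultrafilter (X × X)) :=
    {p | entourage X R ∈ p} ∩ (Ultrafilter.map Prod.fst ⁻¹' V ∩ Ultrafilter.map Prod.snd ⁻¹' V)
  have hZ : IsCompact Z := ((ultrafilter_isClosed_basic _).inter
    ((hV.preimage (continuous_ultrafilter_map _)).inter
      (hV.preimage (continuous_ultrafilter_map _)))).isCompact
  have hZr : Z ⊆ Set.range (Subtype.val : EntourageUnion X → Ultrafilter (X × X)) := by
    rintro p ⟨hp, -⟩
    exact ⟨⟨p, R, hR, mem_betaClosure.2 hp⟩, rfl⟩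
  have hZ' : IsCompact ((Subtype.val : EntourageUnion X → Ultrafilter (X × X)) ⁻¹' Z) := by
    have hind : Topology.IsInducing (Subtype.val : EntourageUnion X → Ultrafilter (X × X)) := ⟨rfl⟩
    rw [hind.isCompact_iff, Set.image_preimage_eq_of_subset hZr]
    exact hZ
  have := hZ'.image continuous_toCoarseArrow
  convert this using 1
  ext g
  constructor
  · rintro ⟨⟨_, hg1, hg2⟩, ⟨p, hp, rfl⟩, rfl⟩
    exact ⟨p, ⟨hp, hg1, hg2⟩, rfl⟩
  · rintro ⟨p, ⟨hp, hg1, hg2⟩, rfl⟩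
    exact ⟨⟨toCoarseArrow X p, hg1, hg2⟩, ⟨p, hp, rfl⟩, rfl⟩

/-- The arrow balls of integer radius are an increasing open cover. -/
theorem IsSpace.exists_subset_arrowBall (hX : IsSpace X) {K : Set (RedArrow V)}
    (hK : IsCompact K) : ∃ R, 0 < R ∧ ∀ g ∈ K, g.1 ∈ arrowBall X R := by
  obtain ⟨n, hn⟩ := hK.elim_directed_cover
    (fun n : ℕ => {g : RedArrow V | g.1 ∈ arrowBall X (n : ℝ)})
    (fun n => (hX.isClopen_arrowBall n).isOpen.preimage continuous_subtype_val)
    (fun g _ => by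
      obtain ⟨R, -, hg⟩ := exists_mem_arrowBall g.1
      obtain ⟨n, hn⟩ := exists_nat_ge R
      exact Set.mem_iUnion.2 ⟨n, arrowBall_mono hn hg⟩)
    (Monotone.directed_le fun m n hmn g hg => arrowBall_mono (by exact_mod_cast hmn) hg)
  exact ⟨n + 1, by positivity, fun g hg => arrowBall_mono (by linarith) (hn hg)⟩

/-- The function `f` on the reduction at infinity is the limit of the function `h` on `X × X`,
which is supported in `E_S`. -/
structure Represents (f : RedArrow V → ℝ) (h : X × X → ℝ) (S : ℝ) : Prop where
  tendsto : ∀ (g : RedArrow V) (p : Ultrafilter (X × X)) (R : ℝ), entourage X R ∈ p →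
    p.map Prod.fst = g.1.1.1 → p.map Prod.snd = g.1.1.2 → Tendsto h p (𝓝 (f g))
  eq_zero : ∀ z, S < dist z.1 z.2 → h z = 0

theorem Represents.mem_arrowBall {f : RedArrow V → ℝ} {h : X × X → ℝ} {S : ℝ}
    (hf : Represents f h S) {g : RedArrow V} (hg : f g ≠ 0) : g.1 ∈ arrowBall X S := by
  obtain ⟨R, -, hR⟩ := exists_mem_arrowBall g.1
  obtain ⟨p, hp, h1, h2⟩ := CoarseGeom.mem_arrowBall.1 hR
  refine CoarseGeom.mem_arrowBall.2 ⟨p, ?_, h1, h2⟩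
  by_contra hS
  refine hg (tendsto_nhds_unique (hf.tendsto g p R hp h1 h2) ?_)
  refine tendsto_const_nhds.congr' ?_
  filter_upwards [Ultrafilter.compl_mem_iff_notMem.2 hS] with z hz
  exact (hf.eq_zero z (not_le.1 hz)).symm

/-- The support of `f` lies over one closure of some `E_S`. Tietze's theorem extends `f` from the
part of it over `V` to all of β(X × X); the extension is restricted to principal ultrafilters and
cut off outside `E_S`. -/
theorem IsSpace.exists_represents (hX : IsSpace X) (hV : IsClosed V) {f : RedArrow V → ℝ}
    (hf : Continuous f) (hfc : HasCompactSupport f) (hf01 : ∀ g, f g ∈ Set.Icc (0 : ℝ) 1) :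
    ∃ S, 0 < S ∧ ∃ h : X × X → ℝ, (∀ z, 0 ≤ h z) ∧ Represents f h S := by
  classical
  obtain ⟨S, hS, hSf⟩ := hX.exists_subset_arrowBall hfc
  let Z : Set (Ultrafilter (X × X)) :=
    {p | entourage X S ∈ p} ∩ (Ultrafilter.map Prod.fst ⁻¹' V ∩ Ultrafilter.map Prod.snd ⁻¹' V)
  have hZ : IsClosed Z := (ultrafilter_isClosed_basic _).inter
    ((hV.preimage (continuous_ultrafilter_map _)).inter
      (hV.preimage (continuous_ultrafilter_map _)))
  let e : Z → EntourageUnion X := fun p => ⟨p.1, S, hS, mem_betaClosure.2 p.2.1⟩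
  have he : Continuous e := continuous_subtype_val.subtype_mk _
  let e' : Z → RedArrow V := fun p => ⟨toCoarseArrow X (e p), p.2.2⟩
  have he' : Continuous e' := (continuous_toCoarseArrow.comp he).subtype_mk _
  obtain ⟨F, hF01, hF⟩ := ContinuousMap.exists_restrict_eq_forall_mem_of_closed
    (⟨fun p => f (e' p), hf.comp he'⟩ : C(Z, ℝ)) (t := Set.Icc 0 1) (fun p => hf01 _)
    ⟨0, by simp⟩ hZ
  refine ⟨S, hS, fun z => if dist z.1 z.2 ≤ S then F (pure z) else 0, fun z => ?_, ?_, ?_⟩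
  · dsimp only
    split_ifs
    exacts [(hF01 _).1, le_rfl]
  · intro g p R hp h1 h2
    by_cases hpS : entourage X S ∈ p
    · have hpZ : p ∈ Z := by
        refine ⟨hpS, ?_, ?_⟩
        · rw [Set.mem_preimage, h1]; exact g.2.1
        · rw [Set.mem_preimage, h2]; exact g.2.2
      have hFp : F p = f g := by
        have := DFunLike.congr_fun hF ⟨p, hpZ⟩
        refine Eq.trans this ?_
        change f (e' ⟨p, hpZ⟩) = f g
        congr 1
        exact Subtype.ext (Subtype.ext (Prod.ext h1 h2))
      have := (F.continuous.tendsto p).comp (Ultrafilter.tendsto_pure_self p)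
      rw [hFp] at this
      refine this.congr' ?_
      filter_upwards [hpS] with z hz
      exact (if_pos hz).symm
    -- Injectivity of `(r,s)`: an ultrafilter over `g` containing `E_S` would have to be `p`.
    · have hg0 : f g = 0 := by
        by_contra hne
        obtain ⟨q, hq, hq1, hq2⟩ := mem_arrowBall.1 (hSf g (subset_tsupport f hne))
        apply hpS
        have hpq : p = q := by
          refine hX.eq_of_marginals_eq (T := max S R) (hS.le.trans (le_max_left _ _))
            (mem_of_superset hp (entourage_mono (le_max_right _ _)))
            (mem_of_superset hq (entourage_mono (le_max_left _ _))) (h1.trans hq1.symm)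
            (h2.trans hq2.symm)
        rwa [hpq]
      rw [hg0]
      refine tendsto_const_nhds.congr' ?_
      filter_upwards [Ultrafilter.compl_mem_iff_notMem.2 hpS] with z hz
      exact (if_neg hz).symm
  · intro z hz
    exact if_neg (not_le.2 hz)

/-- The converse passage: a `[0,1]`-valued function on `X × X` extends continuously to β(X × X). -/
theorem IsSpace.exists_represented (hX : IsSpace X) (hV : IsClosed V) {S : ℝ} (hS : 0 < S)
    {h : X × X → ℝ} (h01 : ∀ z, h z ∈ Set.Icc (0 : ℝ) 1) (hS0 : ∀ z, S < dist z.1 z.2 → h z = 0) :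
    ∃ f : RedArrow V → ℝ, Continuous f ∧ HasCompactSupport f ∧
      (∀ g, f g ∈ Set.Icc (0 : ℝ) 1) ∧ Represents f h S := by
  let h' : X × X → Set.Icc (0 : ℝ) 1 := fun z => ⟨h z, h01 z⟩
  let F : Ultrafilter (X × X) → Set.Icc (0 : ℝ) 1 := Ultrafilter.extend h'
  have hF : Continuous F := continuous_ultrafilter_extend h'
  have hFp : ∀ p : Ultrafilter (X × X), Tendsto h p (𝓝 (F p : ℝ)) := by
    intro p
    have := (continuous_subtype_val.tendsto (F p)).comp
      ((hF.tendsto p).comp (Ultrafilter.tendsto_pure_self p))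
    refine this.congr fun z => ?_
    simp only [Function.comp_apply, F, ultrafilter_extend_pure, h']
  let E : EntourageUnion X ≃ CoarseArrow X :=
    Equiv.ofBijective _ ⟨hX.injective_toCoarseArrow, surjective_toCoarseArrow⟩
  let f₀ : CoarseArrow X → ℝ := fun g => F (E.symm g).1
  have hf₀ : Continuous f₀ := by
    refine continuous_coinduced_dom.2 ?_
    have : f₀ ∘ toCoarseArrow X = fun p => (F p.1 : ℝ) := by
      funext p
      change ((F (E.symm (E p)).1 : Set.Icc (0 : ℝ) 1) : ℝ) = F p.1
      rw [E.symm_apply_apply]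
    rw [this]
    exact continuous_subtype_val.comp (hF.comp continuous_subtype_val)
  have hrep : Represents (fun g : RedArrow V => f₀ g.1) h S := by
    refine ⟨fun g p R hp h1 h2 => ?_, hS0⟩
    have hE : E ⟨p, max R 1, by positivity,
        mem_betaClosure.2 (mem_of_superset hp (entourage_mono (le_max_left _ _)))⟩ = g.1 :=
      Subtype.ext (Prod.ext h1 h2)
    have : f₀ g.1 = F p := by
      change ((F (E.symm g.1).1 : Set.Icc (0 : ℝ) 1) : ℝ) = F p
      rw [← hE, E.symm_apply_apply]
    simp only [this]
    exact hFp p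
  refine ⟨fun g => f₀ g.1, hf₀.comp continuous_subtype_val, ?_, fun g => (F _).2, hrep⟩
  refine HasCompactSupport.intro' (isCompact_redArrowBall hV hS)
    ((hX.isClopen_arrowBall S).isClosed.preimage continuous_subtype_val) fun g hg => ?_
  by_contra hne
  exact hg (hrep.mem_arrowBall hne)

/-- `V` is a union of orbits. -/
def IsSaturated (V : Set (Ultrafilter X)) : Prop :=
  ∀ g : CoarseArrow X, g.1.1 ∈ V ↔ g.1.2 ∈ V

/-- The arrows that can be multiplied by `γ` from the left. -/
abbrev LeftArrow (γ : RedArrow V) : Type _ :=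
  {α : RedArrow V // ((coarseGroupoid X).reduction V).s α = ((coarseGroupoid X).reduction V).r γ}

theorem LeftArrow.snd_eq {γ : RedArrow V} (α : LeftArrow γ) : α.1.1.1.2 = γ.1.1.1 :=
  congrArg Subtype.val α.2

theorem LeftArrow.injective_fst (γ : RedArrow V) :
    Function.Injective fun α : LeftArrow γ => α.1.1.1.1 := by
  intro α β h
  exact Subtype.ext (Subtype.ext (Subtype.ext (Prod.ext h (α.snd_eq.trans β.snd_eq.symm))))

/-- An arrow with source `r(γ)` is determined by its range, so `F` is a function on βX extended by
zero and `IsSpace.hasSum_fiber` applies. Saturation keeps the ranges `p.map g` inside `V`. -/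
theorem IsSpace.hasSum_leftArrow (hX : IsSpace X) (hVs : IsSaturated V) {γ : RedArrow V}
    {p : Ultrafilter (X × X)} (h1 : p.map Prod.fst = γ.1.1.1) {T : ℝ} (hT : 0 ≤ T)
    (k : X → X × X → ℝ) (F : LeftArrow γ → ℝ)
    (hlim : ∀ (g : X × X → X) (α : LeftArrow γ), (∀ᶠ q : X × X in p, dist (g q) q.1 ≤ T) →
      p.map g = α.1.1.1.1 → Tendsto (fun q => k (g q) q) p (𝓝 (F α)))
    (hzero : ∀ α, F α ≠ 0 →
      ∃ g : X × X → X, (∀ᶠ q : X × X in p, dist (g q) q.1 ≤ T) ∧ p.map g = α.1.1.1.1) :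
    ∃ t, HasSum F t ∧ Tendsto (fun q : X × X => ∑ z ∈ hX.cball q.1 T, k z q) p (𝓝 t) := by
  have hinj := LeftArrow.injective_fst γ
  suffices H : ∃ t, HasSum (Function.extend (fun α : LeftArrow γ => α.1.1.1.1) F 0) t ∧
      Tendsto (fun q : X × X => ∑ z ∈ hX.cball q.1 T, k z q) p (𝓝 t) by
    obtain ⟨t, ht1, ht2⟩ := H
    exact ⟨t, (hasSum_extend_zero hinj).1 ht1, ht2⟩
  refine hX.hasSum_fiber p Prod.fst hT k _ ?_ ?_
  · intro g hg
    have hmem : ∃ q : EntourageUnion X, q.1.map Prod.fst = p.map g ∧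
        q.1.map Prod.snd = γ.1.1.1 := by
      refine ⟨⟨p.map fun q => (g q, q.1), max T 1, by positivity, mem_betaClosure.2 ?_⟩, ?_, ?_⟩
      · have : ∀ᶠ q : X × X in p, dist (g q) q.1 ≤ max T 1 := by
          filter_upwards [hg] with q hq
          exact hq.trans (le_max_left T 1)
        exact this
      · exact Ultrafilter.map_map _ _ _
      · rw [← h1]
        exact Ultrafilter.map_map _ _ _
    let β : CoarseArrow X := ⟨(p.map g, γ.1.1.1), hmem⟩
    let α : LeftArrow γ := ⟨⟨β, (hVs β).2 γ.2.1, γ.2.1⟩, rfl⟩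
    have : Function.extend (fun α : LeftArrow γ => α.1.1.1.1) F 0 (p.map g) = F α :=
      hinj.extend_apply F 0 α
    rw [this]
    exact hlim g α hg rfl
  · intro c hc
    by_cases hex : ∃ α : LeftArrow γ, α.1.1.1.1 = c
    · obtain ⟨α, rfl⟩ := hex
      rw [hinj.extend_apply] at hc
      exact hzero α hc
    · rw [Function.extend_apply' _ _ _ hex] at hc
      exact absurd rfl hc

theorem Represents.hasSum (hX : IsSpace X) (hVs : IsSaturated V) {f : RedArrow V → ℝ}
    {h : X × X → ℝ} {S R : ℝ} (hS : 0 ≤ S) (hR : 0 ≤ R) (hf : Represents f h S) {γ : RedArrow V}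
    {p : Ultrafilter (X × X)} (h1 : p.map Prod.fst = γ.1.1.1) :
    ∃ t, HasSum (fun α : LeftArrow γ => f α.1) t ∧
      Tendsto (fun q : X × X => ∑ z ∈ hX.cball q.1 (S + R), h (z, q.1)) p (𝓝 t) := by
  refine hX.hasSum_leftArrow hVs h1 (add_nonneg hS hR) (fun z q => h (z, q.1)) _ ?_ ?_
  · intro g α hg hα
    refine (hf.tendsto α.1 (p.map fun q => (g q, q.1)) (S + R) hg ?_ ?_).comp
      (tendsto_map (f := fun q : X × X => (g q, q.1)))
    · rw [← hα]
      exact Ultrafilter.map_map _ _ _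
    · rw [α.snd_eq, ← h1]
      exact Ultrafilter.map_map _ _ _
  · intro α hα
    obtain ⟨q, hq, hq1, hq2⟩ := CoarseGeom.mem_arrowBall.1 (hf.mem_arrowBall hα)
    obtain ⟨g, hg1, hg2⟩ := hX.exists_selection hS (q.map Prod.fst)
    refine ⟨fun z => g z.1, Eventually.of_forall fun z => (hg1 _).trans (by linarith), ?_⟩
    have : q.map Prod.fst = q.map fun z => g z.2 := ultrafilter_map_congr (hg2 q hq rfl)
    rw [← hq1, this]
    have h3 : p.map Prod.fst = q.map Prod.snd := h1.trans (α.snd_eq.symm.trans hq2.symm)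
    have h4 := congrArg (Ultrafilter.map g) h3
    rw [Ultrafilter.map_map, Ultrafilter.map_map] at h4
    exact h4

theorem Represents.hasSum_abs_sub (hX : IsSpace X) (hVs : IsSaturated V) {f : RedArrow V → ℝ}
    {h : X × X → ℝ} {S R : ℝ} (hS : 0 ≤ S) (hR : 0 ≤ R) (hf : Represents f h S) {γ : RedArrow V}
    {p : Ultrafilter (X × X)} (hp : entourage X R ∈ p) (h1 : p.map Prod.fst = γ.1.1.1)
    (h2 : p.map Prod.snd = γ.1.1.2) :
    ∃ t, HasSum (fun α : LeftArrow γ =>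
        |f α.1 - f (((coarseGroupoid X).reduction V).mul α.1 γ α.2)|) t ∧
      Tendsto (fun q : X × X => ∑ z ∈ hX.cball q.1 (S + R), |h (z, q.1) - h (z, q.2)|) p (𝓝 t) := by
  refine hX.hasSum_leftArrow hVs h1 (add_nonneg hS hR)
    (fun z q => |h (z, q.1) - h (z, q.2)|) _ ?_ ?_
  · intro g α hg hα
    refine Tendsto.abs (Tendsto.sub ?_ ?_)
    · refine (hf.tendsto α.1 (p.map fun q => (g q, q.1)) (S + R) hg ?_ ?_).comp
        (tendsto_map (f := fun q : X × X => (g q, q.1)))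
      · rw [← hα]
        exact Ultrafilter.map_map _ _ _
      · rw [α.snd_eq, ← h1]
        exact Ultrafilter.map_map _ _ _
    · refine (hf.tendsto _ (p.map fun q => (g q, q.2)) (S + R + R) ?_ ?_ ?_).comp
        (tendsto_map (f := fun q : X × X => (g q, q.2)))
      · have hp' : ∀ᶠ q : X × X in p, dist q.1 q.2 ≤ R := hp
        have : ∀ᶠ q : X × X in p, dist (g q) q.2 ≤ S + R + R := by
          filter_upwards [hg, hp'] with q hq1 hq2
          linarith [dist_triangle (g q) q.1 q.2]
        exact this
      · change _ = α.1.1.1.1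
        rw [← hα]
        exact Ultrafilter.map_map _ _ _
      · change _ = γ.1.1.2
        rw [← h2]
        exact Ultrafilter.map_map _ _ _
  · intro α hα
    -- If f(α) = 0 then f(αγ) ≠ 0: the range of α is within `S` of s(γ), hence within `S + R` of
    -- r(γ). This is why the balls have radius `S + R`.
    by_cases hα0 : f α.1 = 0
    · have hα1 : f (((coarseGroupoid X).reduction V).mul α.1 γ α.2) ≠ 0 := by
        intro h0
        rw [hα0, h0] at hα
        simp at hα
      obtain ⟨q, hq, hq1, hq2⟩ := CoarseGeom.mem_arrowBall.1 (hf.mem_arrowBall hα1)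
      have hq1' : q.map Prod.fst = α.1.1.1.1 := hq1
      have hq2' : q.map Prod.snd = γ.1.1.2 := hq2
      obtain ⟨g, hg1, hg2⟩ := hX.exists_selection hS (q.map Prod.fst)
      refine ⟨fun z => g z.2, ?_, ?_⟩
      · have hp' : ∀ᶠ q : X × X in p, dist q.1 q.2 ≤ R := hp
        filter_upwards [hp'] with z hz
        linarith [dist_triangle_right (g z.2) z.1 z.2, hg1 z.2]
      · have : q.map Prod.fst = q.map fun z => g z.2 := ultrafilter_map_congr (hg2 q hq rfl)
        rw [← hq1', this]
        have h4 := congrArg (Ultrafilter.map g) (h2.trans hq2'.symm)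
        rw [Ultrafilter.map_map, Ultrafilter.map_map] at h4
        exact h4
    · obtain ⟨q, hq, hq1, hq2⟩ := CoarseGeom.mem_arrowBall.1 (hf.mem_arrowBall hα0)
      obtain ⟨g, hg1, hg2⟩ := hX.exists_selection hS (q.map Prod.fst)
      refine ⟨fun z => g z.1, Eventually.of_forall fun z => (hg1 _).trans (by linarith), ?_⟩
      have : q.map Prod.fst = q.map fun z => g z.2 := ultrafilter_map_congr (hg2 q hq rfl)
      rw [← hq1, this]
      have h3 : p.map Prod.fst = q.map Prod.snd := h1.trans (α.snd_eq.symm.trans hq2.symm)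
      have h4 := congrArg (Ultrafilter.map g) h3
      rw [Ultrafilter.map_map, Ultrafilter.map_map] at h4
      exact h4

end CoarseGeom

/-! ### Amenability at infinity and almost invariant families. -/

namespace CoarseGeom

variable {X : Type*} [MetricSpace X] {V : Set (Ultrafilter X)}

/-- Almost invariant families of approximate probability measures with uniformly bounded supports,
defined near `V`. -/
def HasAlmostInvariantFamilies (hX : IsSpace X) (V : Set (Ultrafilter X)) : Prop :=
  ∀ R : ℝ, 0 < R → ∀ ε : ℝ, 0 < ε → ∃ S : ℝ, 0 < S ∧ ∃ D : Set X, V ⊆ betaClosure D ∧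
    ∃ h : X → X → ℝ, (∀ x z, 0 ≤ h x z) ∧ (∀ x z, S < dist z x → h x z = 0) ∧
      ∀ x ∈ D, ∀ y ∈ D, dist x y ≤ R →
        |∑ z ∈ hX.cball x (S + R), h x z - 1| < ε ∧
        ∑ z ∈ hX.cball x (S + R), |h x z - h y z| < ε

theorem hasAlmostInvariantFamilies_of_hasPartialPropertyA (hX : IsSpace X) (hV : IsClosed V)
    (hVs : IsSaturated V) (hA : HasPartialPropertyA X V) : HasAlmostInvariantFamilies hX V := by
  intro R hR ε hε
  obtain ⟨f, hf, hfc, hf01, hfK⟩ := hA ε hε {g : RedArrow V | g.1 ∈ arrowBall X R}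
    (isCompact_redArrowBall hV hR)
  obtain ⟨S, hS, h, h0, hfh⟩ := hX.exists_represents hV hf hfc hf01
  let Good : Set (X × X) := {q | |∑ z ∈ hX.cball q.1 (S + R), h (z, q.1) - 1| < ε ∧
    ∑ z ∈ hX.cball q.1 (S + R), |h (z, q.1) - h (z, q.2)| < ε}
  -- The two amenability sums at the arrow defined by `p` are limits along `p` of the sums in
  -- `Good`.
  have hGood : ∀ p : Ultrafilter (X × X), entourage X R ∈ p → p.map Prod.fst ∈ V → Good ∈ p := by
    intro p hp hpV
    let γ₀ : CoarseArrow X := toCoarseArrow X ⟨p, R, hR, mem_betaClosure.2 hp⟩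
    let γ : RedArrow V := ⟨γ₀, hpV, (hVs γ₀).1 hpV⟩
    obtain ⟨h1, t', ht', h2⟩ := hfK γ ⟨⟨p, R, hR, mem_betaClosure.2 hp⟩, hp, rfl⟩
    obtain ⟨t, ht, hlim⟩ := hfh.hasSum hX hVs hS.le hR.le (γ := γ) (p := p) rfl
    obtain ⟨u, hu, hlim'⟩ := hfh.hasSum_abs_sub hX hVs hS.le hR.le (γ := γ) hp rfl rfl
    obtain rfl : t = 1 := ht.unique h1
    obtain rfl : u = t' := hu.unique h2
    have e1 : ∀ᶠ q : X × X in p, |∑ z ∈ hX.cball q.1 (S + R), h (z, q.1) - 1| < ε := by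
      have := Metric.tendsto_nhds.1 hlim ε hε
      simpa only [Real.dist_eq] using this
    have e2 := hlim'.eventually_lt_const ht'
    exact e1.and e2
  refine ⟨S, hS, {x | ∀ y, dist x y ≤ R → (x, y) ∈ Good}, ?_, fun x z => h (z, x),
    fun x z => h0 _, fun x z hz => hfh.eq_zero (z, x) hz, fun x hx y _ hxy => hx y hxy⟩
  intro ω hω
  rw [mem_betaClosure]
  by_contra hD
  have hD' := Ultrafilter.compl_mem_iff_notMem.2 hD
  -- Were `D` not in `ω`, choosing a bad partner `g x` for each `x` outside `D` would give an
  -- ultrafilter over `ω`, the image under `x ↦ (x, g x)`, that contains `E_R` but not `Good`.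
  have hex : ∀ x, ∃ y, x ∈ {x | ∀ y, dist x y ≤ R → (x, y) ∈ Good}ᶜ →
      dist x y ≤ R ∧ (x, y) ∉ Good := by
    intro x
    by_cases hx : x ∈ {x | ∀ y, dist x y ≤ R → (x, y) ∈ Good}ᶜ
    · simp only [mem_compl_iff, mem_ofPred_eq, not_forall] at hx
      obtain ⟨y, hy, hy'⟩ := hx
      exact ⟨y, fun _ => ⟨hy, hy'⟩⟩
    · exact ⟨x, fun h => absurd h hx⟩
  choose g hg using hex
  have hbad : Goodᶜ ∈ ω.map fun x => (x, g x) := by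
    rw [Ultrafilter.mem_map]
    exact mem_of_superset hD' fun x hx => (hg x hx).2
  refine Ultrafilter.compl_mem_iff_notMem.1 hbad (hGood _ ?_ ?_)
  · rw [Ultrafilter.mem_map]
    exact mem_of_superset hD' fun x hx => (hg x hx).1
  · rw [Ultrafilter.map_map]
    exact hω

theorem hasPartialPropertyA_of_almostInvariant (hX : IsSpace X) (hV : IsClosed V)
    (hVs : IsSaturated V)
    (H : ∀ R : ℝ, 0 < R → ∀ ε : ℝ, 0 < ε → ∃ S : ℝ, 0 < S ∧ ∃ D : Set X, V ⊆ betaClosure D ∧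
      ∃ h : X → X → ℝ, (∀ x z, 0 ≤ h x z) ∧ (∀ x z, S < dist z x → h x z = 0) ∧
        ∀ x ∈ D, ∑ z ∈ hX.cball x S, h x z = 1 ∧ ∀ y ∈ D, dist x y ≤ R →
          ∑ z ∈ hX.cball x (S + R), |h x z - h y z| ≤ ε) : HasPartialPropertyA X V := by
  classical
  intro ε hε K hK
  obtain ⟨R, hR, hKR⟩ := hX.exists_subset_arrowBall hK
  -- Only non-strict inequalities survive the limit; `ε / 2` restores strictness.
  obtain ⟨S, hS, D, hD, h, h0, hS0, hh⟩ := H R hR (ε / 2) (half_pos hε)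
  let h' : X × X → ℝ := fun q => if q.2 ∈ D then h q.2 q.1 else 0
  have h'S : ∀ q : X × X, S < dist q.1 q.2 → h' q = 0 := by
    intro q hq
    simp only [h']
    split_ifs
    exacts [hS0 _ _ hq, rfl]
  have h'01 : ∀ q, h' q ∈ Set.Icc (0 : ℝ) 1 := by
    intro q
    simp only [h']
    split_ifs with hq
    · refine ⟨h0 _ _, ?_⟩
      by_cases hq' : S < dist q.1 q.2
      · rw [hS0 _ _ hq']
        exact zero_le_one
      · rw [← (hh q.2 hq).1]
        exact Finset.single_le_sum (f := fun z => h q.2 z) (fun z _ => h0 _ _)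
          (hX.mem_cball.2 (not_lt.1 hq'))
    · simp
  obtain ⟨f, hf, hfc, hf01, hfh⟩ := hX.exists_represented hV hS h'01 h'S
  refine ⟨f, hf, hfc, hf01, fun γ hγ => ?_⟩
  obtain ⟨p, hp, h1, h2⟩ := mem_arrowBall.1 (hKR γ hγ)
  have hD1 : ∀ᶠ q : X × X in p, q.1 ∈ D := by
    have := mem_betaClosure.1 (hD γ.2.1)
    change D ∈ γ.1.1.1 at this
    rw [← h1] at this
    exact this
  have hD2 : ∀ᶠ q : X × X in p, q.2 ∈ D := by
    have := mem_betaClosure.1 (hD γ.2.2)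
    change D ∈ γ.1.1.2 at this
    rw [← h2] at this
    exact this
  have hpR : ∀ᶠ q : X × X in p, dist q.1 q.2 ≤ R := hp
  obtain ⟨t, ht, hlim⟩ := hfh.hasSum hX hVs hS.le hR.le h1
  obtain ⟨u, hu, hlim'⟩ := hfh.hasSum_abs_sub hX hVs hS.le hR.le hp h1 h2
  have ht1 : t = 1 := by
    refine tendsto_nhds_unique hlim (tendsto_const_nhds.congr' ?_)
    filter_upwards [hD1] with q hq
    rw [← (hh q.1 hq).1]
    simp only [h', if_pos hq]
    refine Finset.sum_subset ?_ ?_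
    · intro z hz
      exact hX.mem_cball.2 ((hX.mem_cball.1 hz).trans (by linarith))
    · intro z _ hz
      exact hS0 _ _ (not_le.1 fun hn => hz (hX.mem_cball.2 hn))
  have hu1 : u ≤ ε / 2 := by
    refine le_of_tendsto hlim' ?_
    filter_upwards [hD1, hD2, hpR] with q hq1 hq2 hqR
    simp only [h', if_pos hq1, if_pos hq2]
    exact (hh q.1 hq1).2 q.2 hq2 hqR
  subst ht1
  exact ⟨ht, u, by linarith, hu⟩

theorem isClosed_boundary_sdiff {X : Type*} {U : Set (Ultrafilter X)} (hU : IsOpen U) :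
    IsClosed (boundary X \ U) := by
  have : IsOpen (Set.range (pure : X → Ultrafilter X)) := by
    have he : Set.range (pure : X → Ultrafilter X) = ⋃ x : X, {u | ({x} : Set X) ∈ u} := by
      ext u
      simp only [mem_range, mem_iUnion, mem_ofPred_eq]
      constructor
      · rintro ⟨x, rfl⟩
        exact ⟨x, Ultrafilter.mem_pure.2 rfl⟩
      · rintro ⟨x, hx⟩
        obtain ⟨y, -, hy⟩ := Ultrafilter.eq_pure_of_finite_mem (Set.finite_singleton x) hx
        exact ⟨y, hy.symm⟩
    rw [he]
    exact isOpen_iUnion fun x => ultrafilter_isOpen_basic _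
  exact this.isClosed_compl.sdiff hU

/-- An ultrafilter at finite distance from a point `y` contains a closed ball about `y`, which is
finite, so it is principal. -/
theorem IsSpace.mem_boundary_of_coarse (hX : IsSpace X) (g : CoarseArrow X)
    (h : g.1.1 ∈ boundary X) : g.1.2 ∈ boundary X := by
  rintro ⟨y, hy⟩
  apply h
  obtain ⟨R, -, hR⟩ := coarse_iff.1 g.2
  have hmem : Metric.closedBall y R ∈ g.1.1 := by
    by_contra hn
    obtain ⟨x, hx, z, hz, hxz⟩ := hR _ (Ultrafilter.compl_mem_iff_notMem.2 hn) {y}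
      (by rw [← hy]; exact Ultrafilter.mem_pure.2 rfl)
    rw [mem_singleton_iff] at hz
    subst hz
    exact hx hxz
  obtain ⟨x, -, hx⟩ := Ultrafilter.eq_pure_of_finite_mem (hX.finite_closedBall y R) hmem
  exact ⟨x, hx.symm⟩

theorem IsSpace.isSaturated_boundary_sdiff (hX : IsSpace X) {U : Set (Ultrafilter X)}
    (hU : (coarseGroupoid X).IsInvariant U) : IsSaturated (boundary X \ U) := by
  intro g
  have h1 : g.1.1 ∈ U ↔ g.1.2 ∈ U := by
    have : g ∈ (coarseGroupoid X).r ⁻¹' U ↔ g ∈ (coarseGroupoid X).s ⁻¹' U := by rw [hU]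
    exact this
  have h2 : g.1.1 ∈ boundary X ↔ g.1.2 ∈ boundary X :=
    ⟨hX.mem_boundary_of_coarse g, hX.mem_boundary_of_coarse ⟨(g.1.2, g.1.1), coarse_symm g.2⟩⟩
  rw [Set.mem_sdiff, Set.mem_sdiff, h1, h2]

end CoarseGeom

/-! ### Square-integrable functions on a countable set with atoms. -/

namespace CoarseGeom

section AtomicLp

variable {X : Type*} [MetricSpace X] [MeasurableSpace X] [Countable X] [MeasurableSingletonClass X]
  {H : Type*} [NormedAddCommGroup H] [InnerProductSpace ℂ H] {ν : Measure X}

theorem lp_ext_atoms {f g : Lp H 2 ν} (h : ∀ x, ν {x} ≠ 0 → f x = g x) : f = g :=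
  Lp.ext (ae_iff_of_countable.2 h)

/-- Evaluation at a point of positive measure. -/
noncomputable def evalAt {x : X} (hx : ν {x} ≠ 0) : Lp H 2 ν →ₗ[ℂ] H where
  toFun f := f x
  map_add' f g := ae_iff_of_countable.1 (Lp.coeFn_add f g) x hx
  map_smul' c f := ae_iff_of_countable.1 (Lp.coeFn_smul c f) x hx

theorem lp_sum_apply {ι : Type*} (s : Finset ι) (f : ι → Lp H 2 ν) {x : X} (hx : ν {x} ≠ 0) :
    (∑ i ∈ s, f i : Lp H 2 ν) x = ∑ i ∈ s, f i x :=
  map_sum (evalAt hx) f s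

theorem lp_sub_apply (f g : Lp H 2 ν) {x : X} (hx : ν {x} ≠ 0) : (f - g) x = f x - g x :=
  map_sub (evalAt hx) f g

theorem lp_zero_apply {x : X} (hx : ν {x} ≠ 0) : (0 : Lp H 2 ν) x = 0 :=
  map_zero (evalAt hx)

theorem hasSum_lp_norm_sq (f : Lp H 2 ν) :
    HasSum (fun x => ν.real {x} * ‖f x‖ ^ 2) (‖f‖ ^ 2) := by
  have h1 : ‖f‖ₑ ^ 2 = ∑' x, ‖f x‖ₑ ^ 2 * ν {x} := by
    rw [Lp.enorm_def, eLpNorm_eq_lintegral_rpow_enorm_toReal (by simp) (by simp),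
      ← lintegral_countable', ← ENNReal.rpow_natCast, ← ENNReal.rpow_mul]
    simp
  have h2 : ∑' x, ‖f x‖ₑ ^ 2 * ν {x} ≠ ⊤ := by
    rw [← h1]
    simp
  have h3 := ENNReal.hasSum_toReal h2
  rw [← ENNReal.tsum_toReal_eq (ENNReal.ne_top_of_tsum_ne_top h2), ← h1] at h3
  simpa [mul_comm, Measure.real] using h3

theorem sum_le_lp_norm_sq (f : Lp H 2 ν) (F : Finset X) :
    ∑ x ∈ F, ν.real {x} * ‖f x‖ ^ 2 ≤ ‖f‖ ^ 2 :=
  sum_le_hasSum F (fun _ _ => by positivity) (hasSum_lp_norm_sq f)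

theorem lp_norm_sq_eq_sum {f : Lp H 2 ν} {F : Finset X} (h : ∀ x, ν {x} ≠ 0 → x ∉ F → f x = 0) :
    ‖f‖ ^ 2 = ∑ x ∈ F, ν.real {x} * ‖f x‖ ^ 2 := by
  refine (hasSum_lp_norm_sq f).unique (hasSum_sum_of_ne_finset_zero fun x hx => ?_)
  by_cases h0 : ν {x} = 0
  · simp [Measure.real, h0]
  · simp [h x h0 hx]

variable (hν : ∀ x, ν {x} ≠ ⊤)

/-- The function with value `v` at `x` and `0` elsewhere. -/
noncomputable def atom (x : X) (v : H) : Lp H 2 ν :=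
  indicatorConstLp 2 (measurableSet_singleton x) (hν x) v

theorem atom_apply_self {x : X} (hx : ν {x} ≠ 0) (v : H) : atom hν x v x = v := by
  have := ae_iff_of_countable.1 (indicatorConstLp_coeFn (p := 2) (c := v)
    (hs := measurableSet_singleton x) (hμs := hν x)) x hx
  rw [atom, this]
  simp

theorem atom_apply_of_ne {x y : X} (hy : ν {y} ≠ 0) (hxy : y ≠ x) (v : H) :
    atom hν x v y = 0 := by
  have := ae_iff_of_countable.1 (indicatorConstLp_coeFn (p := 2) (c := v)
    (hs := measurableSet_singleton x) (hμs := hν x)) y hy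
  rw [atom, this]
  simp [hxy]

theorem atom_eq_zero {x : X} (hx : ν {x} = 0) (v : H) : atom hν x v = 0 := by
  refine lp_ext_atoms fun y hy => ?_
  rw [lp_zero_apply hy, atom_apply_of_ne hν hy]
  rintro rfl
  exact hy hx

theorem lpSupport_atom_subset (x : X) (v : H) : lpSupport (atom hν x v) ⊆ {x} := by
  rintro y ⟨hy, hy'⟩
  by_contra hne
  exact hy' (atom_apply_of_ne hν hy hne v)

theorem sum_atom_apply [DecidableEq X] (F : Finset X) (v : X → H) {x : X} (hx : ν {x} ≠ 0) :
    (∑ y ∈ F, atom hν y (v y) : Lp H 2 ν) x = if x ∈ F then v x else 0 := by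
  rw [lp_sum_apply _ _ hx]
  split_ifs with h
  · rw [Finset.sum_eq_single_of_mem x h fun y _ hy => atom_apply_of_ne hν hx hy.symm _,
      atom_apply_self hν hx]
  · refine Finset.sum_eq_zero fun y hy => atom_apply_of_ne hν hx ?_ _
    rintro rfl
    exact h hy

theorem norm_sq_sum_atom (F : Finset X) (v : X → H) :
    ‖(∑ y ∈ F, atom hν y (v y) : Lp H 2 ν)‖ ^ 2 = ∑ y ∈ F, ν.real {y} * ‖v y‖ ^ 2 := by
  classical
  rw [lp_norm_sq_eq_sum (F := F)]
  · refine Finset.sum_congr rfl fun x hx => ?_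
    by_cases h0 : ν {x} = 0
    · simp [Measure.real, h0]
    · rw [sum_atom_apply hν F v h0, if_pos hx]
  · intro x hx hxF
    rw [sum_atom_apply hν F v hx, if_neg hxF]

theorem norm_sq_atom (x : X) (v : H) : ‖atom hν x v‖ ^ 2 = ν.real {x} * ‖v‖ ^ 2 := by
  have := norm_sq_sum_atom hν {x} (fun _ => v)
  simpa using this

/-- The squared norm of the error is a tail of the series for `‖f‖ ^ 2`. -/
theorem tendsto_sum_atom (f : Lp H 2 ν) :
    Tendsto (fun F : Finset X => (∑ y ∈ F, atom hν y (f y) : Lp H 2 ν)) atTop (𝓝 f) := by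
  classical
  rw [tendsto_iff_norm_sub_tendsto_zero]
  have h1 : ∀ F : Finset X, ‖(∑ y ∈ F, atom hν y (f y) : Lp H 2 ν) - f‖ ^ 2 =
      ‖f‖ ^ 2 - ∑ x ∈ F, ν.real {x} * ‖f x‖ ^ 2 := by
    intro F
    have h2 : HasSum (fun x => if x ∈ F then ν.real {x} * ‖f x‖ ^ 2 else 0)
        (∑ x ∈ F, ν.real {x} * ‖f x‖ ^ 2) := by
      have h3 := hasSum_sum_of_ne_finset_zero (s := F) (L := SummationFilter.unconditional X)
        (f := fun x => if x ∈ F then ν.real {x} * ‖f x‖ ^ 2 else 0) fun x hx => if_neg hx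
      rwa [Finset.sum_congr rfl fun x hx => if_pos hx] at h3
    refine (hasSum_lp_norm_sq _).unique (((hasSum_lp_norm_sq f).sub h2).congr_fun ?_)
    intro x
    by_cases h0 : ν {x} = 0
    · simp [Measure.real, h0]
    · rw [lp_sub_apply _ _ h0, sum_atom_apply hν F _ h0]
      split_ifs <;> simp
  have h2 : Tendsto (fun F : Finset X => ‖(∑ y ∈ F, atom hν y (f y) : Lp H 2 ν) - f‖ ^ 2)
      atTop (𝓝 0) := by
    simp_rw [h1]
    have := (hasSum_lp_norm_sq f).const_sub (‖f‖ ^ 2)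
    rwa [sub_self] at this
  have h3 := h2.sqrt
  simpa using h3

theorem exists_sum_atom_lt_norm {a : Lp H 2 ν →L[ℂ] Lp H 2 ν} (ha : a ≠ 0) :
    ∃ (F : Finset X) (v : X → H), (∀ x ∈ F, ν {x} ≠ 0) ∧
      ‖a‖ / 2 * ‖(∑ y ∈ F, atom hν y (v y) : Lp H 2 ν)‖ <
        ‖a (∑ y ∈ F, atom hν y (v y))‖ := by
  classical
  have hpos : 0 < ‖a‖ := (norm_pos_iff (a := a)).2 ha
  obtain ⟨f, hf⟩ : ∃ f, ‖a‖ / 2 * ‖f‖ < ‖a f‖ := by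
    by_contra! hn
    have := a.opNorm_le_bound (by positivity) hn
    linarith
  have h1 := tendsto_sum_atom hν f
  have h2 : Tendsto (fun F : Finset X => ‖a‖ / 2 * ‖(∑ y ∈ F, atom hν y (f y) : Lp H 2 ν)‖)
      atTop (𝓝 (‖a‖ / 2 * ‖f‖)) := h1.norm.const_mul _
  have h3 : Tendsto (fun F : Finset X => ‖a (∑ y ∈ F, atom hν y (f y) : Lp H 2 ν)‖)
      atTop (𝓝 ‖a f‖) := ((a.continuous.tendsto f).comp h1).norm
  obtain ⟨F, hF⟩ := (h2.eventually_lt h3 hf).exists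
  refine ⟨F.filter fun x => ν {x} ≠ 0, f, fun x hx => (Finset.mem_filter.1 hx).2, ?_⟩
  have : (∑ y ∈ F.filter fun x => ν {x} ≠ 0, atom hν y (f y) : Lp H 2 ν) =
      ∑ y ∈ F, atom hν y (f y) := by
    refine Finset.sum_filter_of_ne fun x _ hx h0 => hx (atom_eq_zero hν h0 _)
  rwa [this]

end AtomicLp

end CoarseGeom

/-! ### Cutting vectors into localised pieces. -/

namespace CoarseGeom

theorem sqrt_sub_sqrt_sq_le {a b : ℝ} (ha : 0 ≤ a) (hb : 0 ≤ b) : (√a - √b) ^ 2 ≤ |a - b| := by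
  have h1 : |√a - √b| ≤ √a + √b := by
    rw [abs_le]
    constructor <;> linarith [Real.sqrt_nonneg a, Real.sqrt_nonneg b]
  have h2 : a - b = (√a - √b) * (√a + √b) := by
    nlinarith [Real.sq_sqrt ha, Real.sq_sqrt hb]
  rw [h2, abs_mul, ← sq_abs, sq, abs_of_nonneg (add_nonneg (Real.sqrt_nonneg a) (Real.sqrt_nonneg b))]
  exact mul_le_mul_of_nonneg_left h1 (abs_nonneg _)

theorem norm_sum_sq_le_card_mul {ι E : Type*} [NormedAddCommGroup E] (s : Finset ι) (f : ι → E) :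
    ‖∑ i ∈ s, f i‖ ^ 2 ≤ s.card * ∑ i ∈ s, ‖f i‖ ^ 2 :=
  (pow_le_pow_left₀ (norm_nonneg _) (norm_sum_le s f) 2).trans sq_sum_le_card_mul_sum_sq

theorem sum_eq_sum_of_ne_zero {ι : Type*} {s t : Finset ι} {f : ι → ℝ}
    (hs : ∀ z, f z ≠ 0 → z ∈ s) (ht : ∀ z, f z ≠ 0 → z ∈ t) : ∑ z ∈ s, f z = ∑ z ∈ t, f z := by
  rw [← finsum_eq_sum_of_support_subset f (s := s) fun z hz => hs z hz,
    ← finsum_eq_sum_of_support_subset f (s := t) fun z hz => ht z hz]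

variable {X : Type*} [MetricSpace X] [MeasurableSpace X] [Countable X] [MeasurableSingletonClass X]
  {H : Type*} [NormedAddCommGroup H] [InnerProductSpace ℂ H] {ν : Measure X}

theorem PropagationLE.apply_atom_eq_zero {a : Lp H 2 ν →L[ℂ] Lp H 2 ν} {R : ℝ}
    (ha : PropagationLE a R) (hν : ∀ x, ν {x} ≠ ⊤) {x y : X} (hx : ν {x} ≠ 0) (hxy : R < dist x y)
    (v : H) : a (atom hν y v) x = 0 := by
  by_contra hne
  exact not_le.2 hxy (ha (x, y) ⟨atom hν y v, lpSupport_atom_subset hν y v, hx, hne⟩)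

/-- Localisation of an operator of finite propagation along an almost invariant family. -/
theorem localization_estimate (hX : IsSpace X) (hν : ∀ x, ν {x} ≠ ⊤)
    {a : Lp H 2 ν →L[ℂ] Lp H 2 ν} {R S ε : ℝ} (hR : 0 ≤ R) (hε : 0 ≤ ε) {N : ℕ}
    (hN : ∀ x, (hX.cball x R).card ≤ N) (ha : PropagationLE a R) {D : Set X}
    (hD : ∀ x, ν {x} ≠ 0 → x ∈ D) {h : X → X → ℝ} (h0 : ∀ x z, 0 ≤ h x z)
    (hS0 : ∀ x z, S < dist z x → h x z = 0)
    (hh : ∀ x ∈ D, ∀ y ∈ D, dist x y ≤ R →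
      |∑ z ∈ hX.cball x (S + R), h x z - 1| < ε ∧
      ∑ z ∈ hX.cball x (S + R), |h x z - h y z| < ε)
    (F : Finset X) (hF : ∀ x ∈ F, ν {x} ≠ 0) (v : X → H) :
    ∃ Z : Finset X,
      ∑ z ∈ Z, ‖(∑ y ∈ F, atom hν y (((√(h y z) : ℝ) : ℂ) • v y) : Lp H 2 ν)‖ ^ 2 ≤
        (1 + ε) * ‖(∑ y ∈ F, atom hν y (v y) : Lp H 2 ν)‖ ^ 2 ∧
      (1 - ε) * ‖a (∑ y ∈ F, atom hν y (v y))‖ ^ 2 ≤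
        2 * ∑ z ∈ Z, ‖a (∑ y ∈ F, atom hν y (((√(h y z) : ℝ) : ℂ) • v y))‖ ^ 2 +
        2 * (N * ε * (‖a‖ ^ 2 * ‖(∑ y ∈ F, atom hν y (v y) : Lp H 2 ν)‖ ^ 2)) := by
  classical
  -- The image of a vector supported in `F` lives on `F₁`, and `Z` holds every `z` at which a weight
  -- of a point of `F ∪ F₁` is non-zero. All sums are thereby finite.
  let F₁ : Finset X := (F.biUnion fun y => hX.cball y R).filter fun x => ν {x} ≠ 0
  let Z : Finset X := (F ∪ F₁).biUnion fun y => hX.cball y S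
  have hF₁ : ∀ x ∈ F₁, ν {x} ≠ 0 := fun x hx => (Finset.mem_filter.1 hx).2
  have hZ : ∀ x ∈ F ∪ F₁, ∀ z, h x z ≠ 0 → z ∈ Z := fun x hx z hz =>
    Finset.mem_biUnion.2 ⟨x, hx, hX.mem_cball.2 (not_lt.1 fun hn => hz (hS0 x z hn))⟩
  have hball : ∀ x y z, dist x y ≤ R → h y z ≠ 0 → z ∈ hX.cball x (S + R) := by
    intro x y z hxy hz
    rw [hX.mem_cball]
    have : dist z y ≤ S := not_lt.1 fun hn => hz (hS0 y z hn)
    linarith [dist_triangle_right z x y]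
  have hsum : ∀ x ∈ F ∪ F₁, ν {x} ≠ 0 → |∑ z ∈ Z, h x z - 1| ≤ ε := by
    intro x hx hx0
    rw [sum_eq_sum_of_ne_zero (t := hX.cball x (S + R)) (hZ x hx)
      (fun z hz => hball x x z (by simpa using hR) hz)]
    exact (hh x (hD x hx0) x (hD x hx0) (by simpa using hR)).1.le
  have hvar : ∀ x ∈ F₁, ∀ y ∈ F, dist x y ≤ R → ∑ z ∈ Z, (√(h x z) - √(h y z)) ^ 2 ≤ ε := by
    intro x hx y hy hxy
    refine (Finset.sum_le_sum fun z _ => sqrt_sub_sqrt_sq_le (h0 x z) (h0 y z)).trans ?_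
    have hne : ∀ z, |h x z - h y z| ≠ 0 → h x z ≠ 0 ∨ h y z ≠ 0 := by
      intro z hz
      by_contra! hn
      simp [hn.1, hn.2] at hz
    rw [sum_eq_sum_of_ne_zero (t := hX.cball x (S + R))]
    · exact (hh x (hD x (hF₁ x hx)) y (hD y (hF y hy)) hxy).2.le
    · intro z hz
      rcases hne z hz with h1 | h1
      · exact hZ x (Finset.mem_union_right _ hx) z h1
      · exact hZ y (Finset.mem_union_left _ hy) z h1
    · intro z hz
      rcases hne z hz with h1 | h1
      · exact hball x x z (by simpa using hR) h1
      · exact hball x y z hxy h1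
  set A : X → X → H := fun x y => a (atom hν y (v y)) x with hA
  have hA0 : ∀ x y, ν {x} ≠ 0 → R < dist x y → A x y = 0 := fun x y hx hxy =>
    ha.apply_atom_eq_zero hν hx hxy _
  have hsmul : ∀ (c : ℂ) (y : X) (w : H), atom hν y (c • w) = c • atom hν y w := by
    intro c y w
    refine lp_ext_atoms fun x hx => ?_
    have : (c • atom hν y w : Lp H 2 ν) x = c • atom hν y w x := map_smul (evalAt hx) c _
    rw [this]
    by_cases hxy : x = y
    · subst hxy
      rw [atom_apply_self hν hx, atom_apply_self hν hx]
    · rw [atom_apply_of_ne hν hx hxy, atom_apply_of_ne hν hx hxy, smul_zero]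
  have happ : ∀ (c : X → ℂ) (x : X), ν {x} ≠ 0 →
      a (∑ y ∈ F, atom hν y (c y • v y)) x = ∑ y ∈ F, c y • A x y := by
    intro c x hx
    rw [map_sum, lp_sum_apply _ _ hx]
    refine Finset.sum_congr rfl fun y _ => ?_
    rw [hsmul, map_smul]
    exact map_smul (evalAt hx) (c y) _
  have happ1 : ∀ x, ν {x} ≠ 0 → a (∑ y ∈ F, atom hν y (v y)) x = ∑ y ∈ F, A x y := by
    intro x hx
    simpa using happ (fun _ => 1) x hx
  have hoff : ∀ x, ν {x} ≠ 0 → x ∉ F₁ → ∀ y ∈ F, A x y = 0 := by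
    intro x hx hx1 y hy
    refine hA0 x y hx (not_le.1 fun hn => hx1 ?_)
    exact Finset.mem_filter.2 ⟨Finset.mem_biUnion.2 ⟨y, hy, hX.mem_cball.2 hn⟩, hx⟩
  refine ⟨Z, ?_, ?_⟩
  · simp_rw [norm_sq_sum_atom]
    rw [Finset.sum_comm, Finset.mul_sum]
    refine Finset.sum_le_sum fun y hy => ?_
    have h1 : ∀ z, ν.real {y} * ‖((√(h y z) : ℝ) : ℂ) • v y‖ ^ 2 =
        h y z * (ν.real {y} * ‖v y‖ ^ 2) := by
      intro z
      rw [norm_smul, mul_pow, Complex.norm_real, Real.norm_eq_abs, sq_abs, Real.sq_sqrt (h0 y z)]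
      ring
    simp_rw [h1]
    rw [← Finset.sum_mul]
    refine mul_le_mul_of_nonneg_right ?_ (by positivity)
    have := (abs_le.1 (hsum y (Finset.mem_union_left _ hy) (hF y hy))).2
    linarith
  · have hη : ‖a (∑ y ∈ F, atom hν y (v y))‖ ^ 2 =
        ∑ x ∈ F₁, ν.real {x} * ‖∑ y ∈ F, A x y‖ ^ 2 := by
      rw [lp_norm_sq_eq_sum (F := F₁)]
      · exact Finset.sum_congr rfl fun x hx => by rw [happ1 x (hF₁ x hx)]
      · intro x hx hx1
        rw [happ1 x hx]
        exact Finset.sum_eq_zero (hoff x hx hx1)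
    have hηz : ∀ z, ∑ x ∈ F₁, ν.real {x} * ‖∑ y ∈ F, ((√(h y z) : ℝ) : ℂ) • A x y‖ ^ 2 ≤
        ‖a (∑ y ∈ F, atom hν y (((√(h y z) : ℝ) : ℂ) • v y))‖ ^ 2 := by
      intro z
      refine le_trans (le_of_eq ?_) (sum_le_lp_norm_sq _ F₁)
      exact Finset.sum_congr rfl fun x hx => by rw [happ _ x (hF₁ x hx)]
    -- The commutators of `a` with multiplication by √h(·,z), at the point `x`. At most `N` indices
    -- `y` contribute, so Cauchy–Schwarz costs a factor `N`; the sum over `z` of squared differences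
    -- of roots is at most `ε`.
    have hcomm : ∀ x ∈ F₁,
        ∑ z ∈ Z, ‖∑ y ∈ F, (((√(h x z) - √(h y z) : ℝ)) : ℂ) • A x y‖ ^ 2 ≤
          N * ε * ∑ y ∈ F, ‖A x y‖ ^ 2 := by
      intro x hx
      let B := F.filter fun y => dist x y ≤ R
      have hB : ∀ z, ∑ y ∈ F, (((√(h x z) - √(h y z) : ℝ)) : ℂ) • A x y =
          ∑ y ∈ B, (((√(h x z) - √(h y z) : ℝ)) : ℂ) • A x y := by
        intro z
        refine (Finset.sum_filter_of_ne fun y _ hne => ?_).symm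
        by_contra hn
        exact hne (by rw [hA0 x y (hF₁ x hx) (not_le.1 hn), smul_zero])
      have hBc : (B.card : ℝ) ≤ N := by
        have : B ⊆ hX.cball x R := fun y hy =>
          hX.mem_cball.2 (by rw [dist_comm]; exact (Finset.mem_filter.1 hy).2)
        exact_mod_cast (Finset.card_le_card this).trans (hN x)
      calc ∑ z ∈ Z, ‖∑ y ∈ F, (((√(h x z) - √(h y z) : ℝ)) : ℂ) • A x y‖ ^ 2
          ≤ ∑ z ∈ Z, N * ∑ y ∈ B, (√(h x z) - √(h y z)) ^ 2 * ‖A x y‖ ^ 2 := by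
            refine Finset.sum_le_sum fun z _ => ?_
            rw [hB]
            refine (norm_sum_sq_le_card_mul _ _).trans ?_
            refine mul_le_mul hBc (le_of_eq ?_) (by positivity) (by positivity)
            refine Finset.sum_congr rfl fun y _ => ?_
            rw [norm_smul, mul_pow, Complex.norm_real, Real.norm_eq_abs, sq_abs]
        _ = N * ∑ y ∈ B, (∑ z ∈ Z, (√(h x z) - √(h y z)) ^ 2) * ‖A x y‖ ^ 2 := by
            rw [← Finset.mul_sum, Finset.sum_comm]
            simp_rw [Finset.sum_mul]
        _ ≤ N * ∑ y ∈ B, ε * ‖A x y‖ ^ 2 := by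
            gcongr with y hy
            exact hvar x hx y (Finset.mem_filter.1 hy).1 (Finset.mem_filter.1 hy).2
        _ = N * ε * ∑ y ∈ B, ‖A x y‖ ^ 2 := by rw [← Finset.mul_sum, mul_assoc]
        _ ≤ N * ε * ∑ y ∈ F, ‖A x y‖ ^ 2 := by
            refine mul_le_mul_of_nonneg_left ?_ (by positivity)
            exact Finset.sum_le_sum_of_subset_of_nonneg (Finset.filter_subset _ _)
              fun _ _ _ => by positivity
    -- Column by column: column `y` is the image under `a` of a single atom.
    have hcols : ∑ x ∈ F₁, ν.real {x} * ∑ y ∈ F, ‖A x y‖ ^ 2 ≤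
        ‖a‖ ^ 2 * ‖(∑ y ∈ F, atom hν y (v y) : Lp H 2 ν)‖ ^ 2 := by
      simp_rw [Finset.mul_sum]
      rw [Finset.sum_comm, norm_sq_sum_atom, Finset.mul_sum]
      refine Finset.sum_le_sum fun y _ => ?_
      refine (sum_le_lp_norm_sq (a (atom hν y (v y))) F₁).trans ?_
      rw [← norm_sq_atom hν, ← mul_pow]
      exact pow_le_pow_left₀ (norm_nonneg _) (a.le_opNorm _) 2
    have hpt : ∀ x ∈ F₁, (1 - ε) * ‖∑ y ∈ F, A x y‖ ^ 2 ≤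
        2 * ∑ z ∈ Z, ‖∑ y ∈ F, ((√(h y z) : ℝ) : ℂ) • A x y‖ ^ 2 +
        2 * (N * ε * ∑ y ∈ F, ‖A x y‖ ^ 2) := by
      intro x hx
      have h1 : (1 - ε) * ‖∑ y ∈ F, A x y‖ ^ 2 ≤
          ∑ z ∈ Z, ‖((√(h x z) : ℝ) : ℂ) • ∑ y ∈ F, A x y‖ ^ 2 := by
        have h2 : ∀ z, ‖((√(h x z) : ℝ) : ℂ) • ∑ y ∈ F, A x y‖ ^ 2 =
            h x z * ‖∑ y ∈ F, A x y‖ ^ 2 := by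
          intro z
          rw [norm_smul, mul_pow, Complex.norm_real, Real.norm_eq_abs, sq_abs,
            Real.sq_sqrt (h0 x z)]
        simp_rw [h2]
        rw [← Finset.sum_mul]
        refine mul_le_mul_of_nonneg_right ?_ (by positivity)
        have := (abs_le.1 (hsum x (Finset.mem_union_right _ hx) (hF₁ x hx))).1
        linarith
      refine h1.trans ?_
      have h3 : ∀ z ∈ Z, ‖((√(h x z) : ℝ) : ℂ) • ∑ y ∈ F, A x y‖ ^ 2 ≤
          2 * ‖∑ y ∈ F, ((√(h y z) : ℝ) : ℂ) • A x y‖ ^ 2 +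
          2 * ‖∑ y ∈ F, (((√(h x z) - √(h y z) : ℝ)) : ℂ) • A x y‖ ^ 2 := by
        intro z _
        have h4 : ((√(h x z) : ℝ) : ℂ) • ∑ y ∈ F, A x y =
            ∑ y ∈ F, ((√(h y z) : ℝ) : ℂ) • A x y +
            ∑ y ∈ F, (((√(h x z) - √(h y z) : ℝ)) : ℂ) • A x y := by
          rw [← Finset.sum_add_distrib, Finset.smul_sum]
          refine Finset.sum_congr rfl fun y _ => ?_
          rw [← add_smul]
          congr 1
          push_cast
          ring
        rw [h4]
        generalize ∑ y ∈ F, ((√(h y z) : ℝ) : ℂ) • A x y = p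
        generalize ∑ y ∈ F, (((√(h x z) - √(h y z) : ℝ)) : ℂ) • A x y = q
        have h5 := pow_le_pow_left₀ (norm_nonneg _) (norm_add_le p q) 2
        nlinarith [sq_nonneg (‖p‖ - ‖q‖)]
      refine (Finset.sum_le_sum h3).trans ?_
      rw [Finset.sum_add_distrib, ← Finset.mul_sum, ← Finset.mul_sum]
      linarith [hcomm x hx]
    calc (1 - ε) * ‖a (∑ y ∈ F, atom hν y (v y))‖ ^ 2
        = ∑ x ∈ F₁, ν.real {x} * ((1 - ε) * ‖∑ y ∈ F, A x y‖ ^ 2) := by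
          rw [hη, Finset.mul_sum]
          exact Finset.sum_congr rfl fun x _ => by ring
      _ ≤ ∑ x ∈ F₁, ν.real {x} *
            (2 * ∑ z ∈ Z, ‖∑ y ∈ F, ((√(h y z) : ℝ) : ℂ) • A x y‖ ^ 2 +
              2 * (N * ε * ∑ y ∈ F, ‖A x y‖ ^ 2)) :=
          Finset.sum_le_sum fun x hx => mul_le_mul_of_nonneg_left (hpt x hx) (by positivity)
      _ = 2 * ∑ z ∈ Z, ∑ x ∈ F₁, ν.real {x} * ‖∑ y ∈ F, ((√(h y z) : ℝ) : ℂ) • A x y‖ ^ 2 +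
            2 * (N * ε * ∑ x ∈ F₁, ν.real {x} * ∑ y ∈ F, ‖A x y‖ ^ 2) := by
          rw [Finset.sum_comm, Finset.mul_sum, Finset.mul_sum, Finset.mul_sum,
            ← Finset.sum_add_distrib]
          refine Finset.sum_congr rfl fun x _ => ?_
          rw [← Finset.mul_sum]
          ring
      _ ≤ _ := by
          refine add_le_add (mul_le_mul_of_nonneg_left
            (Finset.sum_le_sum fun z _ => hηz z) zero_le_two) ?_
          refine mul_le_mul_of_nonneg_left ?_ zero_le_two
          exact mul_le_mul_of_nonneg_left hcols (by positivity)

end CoarseGeom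

/-! ### Almost invariant families give operator norm localisation. -/

namespace CoarseGeom

variable {X : Type*} [MetricSpace X] [MeasurableSpace X]
  {H : Type*} [NormedAddCommGroup H] [InnerProductSpace ℂ H] {ν : Measure X}

theorem IsSpace.measure_singleton_ne_top (_hX : IsSpace X) [IsLocallyFiniteMeasure ν] (x : X) :
    ν {x} ≠ ⊤ := by
  obtain ⟨s, hs, hs'⟩ := ν.finiteAt_nhds x
  exact ((measure_mono (Set.singleton_subset_iff.2 (mem_of_mem_nhds hs))).trans_lt hs').ne

theorem IsSpace.mem_support_iff (hX : IsSpace X) {x : X} : x ∈ ν.support ↔ ν {x} ≠ 0 := by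
  rw [Measure.mem_support_iff_forall]
  constructor
  · intro h
    exact (h {x} ((hX.isOpen_singleton x).mem_nhds rfl)).ne'
  · intro h U hU
    exact (pos_iff_ne_zero.2 h).trans_le
      (measure_mono (Set.singleton_subset_iff.2 (mem_of_mem_nhds hU)))

theorem ediam_lpSupport_le [Countable X] {ζ : Lp H 2 ν} {z : X} {S : ℝ}
    (h : ∀ x, ν {x} ≠ 0 → ζ x ≠ 0 → dist z x ≤ S) :
    Metric.ediam (lpSupport ζ) ≤ ENNReal.ofReal (2 * S) := by
  refine Metric.ediam_le fun x hx y hy => ?_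
  rw [edist_dist]
  refine ENNReal.ofReal_le_ofReal ?_
  linarith [dist_triangle_left x y z, h x hx.1 hx.2, h y hy.1 hy.2]

/-- Let `‖a η‖` exceed `‖a‖ * ‖η‖ / 2`. If every piece satisfied the opposite bound with factor
1/10, `localization_estimate` would give (1 - ε)/4 < 2(1 + ε)/100 + 2Nε, which is false once ε and
Nε are at most 1/100. The pieces live in balls of radius `S`, hence the diameter `2 * S`. -/
theorem hasPartialONL_of_almostInvariantFamilies [BorelSpace X] [Nontrivial H] (hX : IsSpace X)
    {V : Set (Ultrafilter X)} (hV : HasAlmostInvariantFamilies hX V) : HasPartialONL X H V := by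
  classical
  have hcount := hX.countable
  refine ⟨1 / 10, by norm_num, by norm_num, fun R hR => ?_⟩
  obtain ⟨N, hN⟩ := hX.exists_card_cball_le R
  set ε : ℝ := 1 / (100 * (N + 1)) with hε_def
  have hε : 0 < ε := by positivity
  have hε1 : ε ≤ 1 / 100 := by
    rw [hε_def]
    refine one_div_le_one_div_of_le (by norm_num) ?_
    linarith [Nat.cast_nonneg (α := ℝ) N]
  have hNε : N * ε ≤ 1 / 100 := by
    rw [hε_def, mul_one_div, div_le_div_iff₀ (by positivity) (by norm_num)]
    linarith
  obtain ⟨S, hS, D, hD, h, h0, hS0, hh⟩ := hV R hR ε hε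
  refine ⟨2 * S, by positivity, D, hD, fun ν _ hν0 hνD a ha => ?_⟩
  have hν : ∀ x, ν {x} ≠ ⊤ := fun x => hX.measure_singleton_ne_top x
  have hνD' : ∀ x, ν {x} ≠ 0 → x ∈ D := fun x hx => hνD (hX.mem_support_iff.2 hx)
  -- For `a = 0` only a non-zero localised vector is needed; an atom serves.
  by_cases ha0 : a = 0
  · obtain ⟨x, hx⟩ : ∃ x, ν {x} ≠ 0 := by
      by_contra! hn
      refine hν0 (Measure.measure_univ_eq_zero.1 ?_)
      rw [← Set.biUnion_of_singleton (Set.univ : Set X),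
        measure_biUnion_null_iff (Set.to_countable _)]
      exact fun x _ => hn x
    obtain ⟨e, he⟩ := exists_ne (0 : H)
    refine ⟨atom hν x e, ?_, ?_, ?_⟩
    · intro h0
      apply he
      rw [← atom_apply_self hν hx e, h0, lp_zero_apply hx]
    · refine ediam_lpSupport_le (z := x) fun y hy hy' => ?_
      have : y = x := lpSupport_atom_subset hν x e ⟨hy, hy'⟩
      rw [this, dist_self]
      exact hS.le
    · have : ‖a‖ = 0 := by
        rw [ha0]
        exact ContinuousLinearMap.opNorm_zero
      rw [this, mul_zero, zero_mul]
      exact norm_nonneg _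
  · obtain ⟨F, v, hF, hlt⟩ := exists_sum_atom_lt_norm hν ha0
    obtain ⟨Z, hZ1, hZ2⟩ := localization_estimate hX hν hR.le hε.le hN ha hνD' h0 hS0 hh F hF v
    have hex : ∃ z ∈ Z, ‖a‖ / 10 * ‖(∑ y ∈ F, atom hν y (((√(h y z) : ℝ) : ℂ) • v y) : Lp H 2 ν)‖ <
        ‖a (∑ y ∈ F, atom hν y (((√(h y z) : ℝ) : ℂ) • v y))‖ := by
      by_contra! hn
      set η : Lp H 2 ν := ∑ y ∈ F, atom hν y (v y) with hη
      have h1 : ∑ z ∈ Z, ‖a (∑ y ∈ F, atom hν y (((√(h y z) : ℝ) : ℂ) • v y))‖ ^ 2 ≤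
          (‖a‖ / 10) ^ 2 * ((1 + ε) * ‖η‖ ^ 2) := by
        refine le_trans ?_ (mul_le_mul_of_nonneg_left hZ1 (by positivity))
        rw [Finset.mul_sum]
        refine Finset.sum_le_sum fun z hz => ?_
        rw [← mul_pow]
        exact pow_le_pow_left₀ (norm_nonneg _) (hn z hz) 2
      have h2 : (‖a‖ / 2 * ‖η‖) ^ 2 < ‖a η‖ ^ 2 :=
        pow_lt_pow_left₀ hlt (by positivity) two_ne_zero
      have h3 : 0 ≤ ‖a‖ ^ 2 * ‖η‖ ^ 2 := by positivity
      have h4 : N * ε * (‖a‖ ^ 2 * ‖η‖ ^ 2) ≤ 1 / 100 * (‖a‖ ^ 2 * ‖η‖ ^ 2) :=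
        mul_le_mul_of_nonneg_right hNε h3
      have h5 : ε * (‖a‖ ^ 2 * ‖η‖ ^ 2) ≤ 1 / 100 * (‖a‖ ^ 2 * ‖η‖ ^ 2) :=
        mul_le_mul_of_nonneg_right hε1 h3
      have h6 : ε * ‖a η‖ ^ 2 ≤ 1 / 100 * ‖a η‖ ^ 2 :=
        mul_le_mul_of_nonneg_right hε1 (by positivity)
      nlinarith
    obtain ⟨z, -, hz⟩ := hex
    refine ⟨∑ y ∈ F, atom hν y (((√(h y z) : ℝ) : ℂ) • v y), ?_,
      ediam_lpSupport_le (z := z) fun x hx hx' => ?_, ?_⟩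
    · intro h0
      rw [h0, map_zero, norm_zero, mul_zero] at hz
      exact lt_irrefl _ hz
    · rw [sum_atom_apply hν F _ hx] at hx'
      by_contra hn
      apply hx'
      simp [hS0 x z (not_le.1 hn)]
    · refine le_trans (le_of_eq ?_) hz.le
      ring

end CoarseGeom

/-! ### Separating localised kernels from kernels close to 1. -/

namespace CoarseGeom

variable {X : Type*} [MetricSpace X]

/-- Functions supported in a subset of `F` of diameter at most `S`. -/
def IsLocalized (F : Finset X) (S : ℝ) (ξ : X → ℝ) : Prop :=
  (∀ x, ξ x ≠ 0 → x ∈ F) ∧ ∀ x y, ξ x ≠ 0 → ξ y ≠ 0 → dist x y ≤ S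

theorem IsLocalized.smul {F : Finset X} {S : ℝ} {ξ : X → ℝ} (h : IsLocalized F S ξ) (t : ℝ) :
    IsLocalized F S fun x => t * ξ x :=
  ⟨fun x hx => h.1 x (right_ne_zero_of_mul hx),
    fun x y hx hy => h.2 x y (right_ne_zero_of_mul hx) (right_ne_zero_of_mul hy)⟩

/-- The cone of sums of rank one kernels of localized functions. -/
def localizedCone (F : Finset X) (S : ℝ) : Submodule NNReal (X → X → ℝ) :=
  Submodule.span NNReal {k | ∃ ξ : X → ℝ, IsLocalized F S ξ ∧ k = fun x y => ξ x * ξ y}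

theorem exists_of_mem_localizedCone {F : Finset X} {S : ℝ} {k : X → X → ℝ}
    (hk : k ∈ localizedCone F S) :
    ∃ (n : ℕ) (ξ : Fin n → X → ℝ), (∀ i, IsLocalized F S (ξ i)) ∧
      ∀ x y, k x y = ∑ i, ξ i x * ξ i y := by
  obtain ⟨n, f, g, rfl⟩ := Submodule.mem_span_set'.1 hk
  choose ξ hξ hg using fun i => (g i).2
  refine ⟨n, fun i x => √(f i) * ξ i x, fun i => (hξ i).smul _, fun x y => ?_⟩
  rw [Finset.sum_apply, Finset.sum_apply]
  refine Finset.sum_congr rfl fun i _ => ?_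
  rw [hg i]
  change (f i : ℝ) * (ξ i x * ξ i y) = _
  rw [mul_mul_mul_comm, Real.mul_self_sqrt (f i).coe_nonneg]

theorem convex_localizedCone (F : Finset X) (S : ℝ) :
    Convex ℝ (localizedCone F S : Set (X → X → ℝ)) := by
  intro x hx y hy a b ha hb _
  exact (localizedCone F S).add_mem ((localizedCone F S).smul_mem (⟨a, ha⟩ : NNReal) hx)
    ((localizedCone F S).smul_mem (⟨b, hb⟩ : NNReal) hy)

/-- The kernels on `F` that are close to `1` on the entourage `E_R`. -/
def nearOneKernels (F : Finset X) (R ε : ℝ) : Set (X → X → ℝ) :=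
  {k | (∀ x ∈ F, 1 - ε < k x x ∧ k x x < 1) ∧
    ∀ x ∈ F, ∀ y ∈ F, dist x y ≤ R → 1 - ε < k x y}

theorem isOpen_nearOneKernels (F : Finset X) (R ε : ℝ) : IsOpen (nearOneKernels F R ε) := by
  have h : ∀ x y : X, Continuous fun k : X → X → ℝ => k x y := fun x y =>
    (continuous_apply y).comp (continuous_apply x)
  have : nearOneKernels F R ε =
      (⋂ x ∈ F, {k : X → X → ℝ | 1 - ε < k x x} ∩ {k | k x x < 1}) ∩
      ⋂ x ∈ F, ⋂ y ∈ F, {k : X → X → ℝ | dist x y ≤ R → 1 - ε < k x y} := by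
    ext k
    simp [nearOneKernels]
  rw [this]
  refine IsOpen.inter (isOpen_biInter_finset fun x _ => ?_)
    (isOpen_biInter_finset fun x _ => isOpen_biInter_finset fun y _ => ?_)
  · exact (isOpen_lt continuous_const (h x x)).inter (isOpen_lt (h x x) continuous_const)
  · by_cases hxy : dist x y ≤ R
    · simpa [hxy] using isOpen_lt continuous_const (h x y)
    · simp [hxy]

theorem convex_nearOneKernels (F : Finset X) (R ε : ℝ) : Convex ℝ (nearOneKernels F R ε) := by
  intro k hk l hl a b ha hb hab
  have key : ∀ (t : ℝ) (x y : X), t < k x y → t < l x y → t < (a • k + b • l) x y := by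
    intro t x y h1 h2
    exact (convex_Ioi t) h1 h2 ha hb hab
  refine ⟨fun x hx => ⟨key _ x x (hk.1 x hx).1 (hl.1 x hx).1, ?_⟩, fun x hx y hy hxy =>
    key _ x y (hk.2 x hx y hy hxy) (hl.2 x hx y hy hxy)⟩
  exact (convex_Iio (1 : ℝ)) (hk.1 x hx).2 (hl.1 x hx).2 ha hb hab

theorem functional_apply_eq_sum {X : Type*} [DecidableEq X] {F : Finset X} (f : (X → X → ℝ) →ₗ[ℝ] ℝ)
    {k : X → X → ℝ} (hk : ∀ x y, k x y ≠ 0 → x ∈ F ∧ y ∈ F) :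
    f k = ∑ x ∈ F, ∑ y ∈ F, f (Pi.single x (Pi.single y 1)) * k x y := by
  have h1 : k = ∑ x ∈ F, ∑ y ∈ F, k x y • Pi.single x (Pi.single y (1 : ℝ)) := by
    funext a b
    simp only [Finset.sum_apply, Pi.smul_apply, smul_eq_mul]
    have h2 : ∀ x y, k x y * (Pi.single x (Pi.single y (1 : ℝ)) : X → X → ℝ) a b =
        if x = a then (if y = b then k x y else 0) else 0 := by
      intro x y
      by_cases hx : x = a
      · subst hx
        by_cases hy : y = b
        · subst hy
          simp
        · simp [hy]
      · simp [hx]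
    simp_rw [h2]
    by_cases hab : k a b = 0
    · rw [hab]
      refine (Finset.sum_eq_zero fun x _ => Finset.sum_eq_zero fun y _ => ?_).symm
      split_ifs with h3 h4
      · rw [h3, h4, hab]
      · rfl
      · rfl
    · have := hk a b hab
      rw [Finset.sum_eq_single_of_mem a this.1 (fun x _ hx => by simp [hx]),
        Finset.sum_eq_single_of_mem b this.2 (fun y _ hy => by simp [hy])]
      simp
  conv_lhs => rw [h1]
  simp only [map_sum, map_smul, smul_eq_mul, mul_comm]

/-- A separating functional is non-negative on the cone. It is bounded above on the open set, which
is stable under raising off-diagonal entries and under any change of entries at distance more than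
`R`: this forces the signs and the zeros of `b`. -/
theorem exists_separating_matrix [DecidableEq X] {F : Finset X} {R S ε : ℝ} (hε : 0 < ε)
    (hdis : Disjoint (nearOneKernels F R ε) (localizedCone F S : Set (X → X → ℝ))) :
    ∃ b : X → X → ℝ,
      (∀ ξ, IsLocalized F S ξ → 0 ≤ ∑ x ∈ F, ∑ y ∈ F, b x y * (ξ x * ξ y)) ∧
      (∀ x y, x ≠ y → b x y ≤ 0) ∧ (∀ x y, x ≠ y → R < dist x y → b x y = 0) ∧
      ∑ x ∈ F, ∑ y ∈ F, b x y *
        (if x = y then 1 - ε / 4 else if dist x y ≤ R then 1 - ε / 2 else 0) < 0 := by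
  obtain ⟨f, u, hfu, huf⟩ := geometric_hahn_banach_open (convex_nearOneKernels F R ε)
    (isOpen_nearOneKernels F R ε) (convex_localizedCone F S) hdis
  have hu : u ≤ 0 := by simpa using huf 0 (localizedCone F S).zero_mem
  obtain ⟨b, hb⟩ : ∃ b : X → X → ℝ, ∀ x y, b x y = f (Pi.single x (Pi.single y 1)) :=
    ⟨_, fun _ _ => rfl⟩
  have hsum : ∀ k : X → X → ℝ, (∀ x y, k x y ≠ 0 → x ∈ F ∧ y ∈ F) →
      f k = ∑ x ∈ F, ∑ y ∈ F, b x y * k x y := by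
    intro k hk
    simp only [hb]
    exact functional_apply_eq_sum (f : (X → X → ℝ) →ₗ[ℝ] ℝ) hk
  have hpos : ∀ ξ, IsLocalized F S ξ → 0 ≤ ∑ x ∈ F, ∑ y ∈ F, b x y * (ξ x * ξ y) := by
    intro ξ hξ
    rw [← hsum (fun x y => ξ x * ξ y) fun x y h =>
      ⟨hξ.1 x (left_ne_zero_of_mul h), hξ.1 y (right_ne_zero_of_mul h)⟩]
    by_contra! hn
    have hmem : (fun x y => ξ x * ξ y : X → X → ℝ) ∈ localizedCone F S :=
      Submodule.subset_span ⟨ξ, hξ, rfl⟩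
    set q := f fun x y => ξ x * ξ y with hq
    -- This multiple of the kernel would have value `u - 1`, below the bound `u` valid on the cone.
    have ht : 0 ≤ (u - 1) / q := div_nonneg_of_nonpos (by linarith) hn.le
    have h1 := huf _ ((localizedCone F S).smul_mem (⟨(u - 1) / q, ht⟩ : NNReal) hmem)
    have h2 : f ((⟨(u - 1) / q, ht⟩ : NNReal) • fun x y => ξ x * ξ y) = (u - 1) / q * q :=
      map_smul f ((u - 1) / q) _
    have h3 : u ≤ (u - 1) / q * q := h1.trans_eq h2
    rw [div_mul_cancel₀ _ hn.ne] at h3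
    linarith
  -- A test kernel in the open set. Its diagonal value exceeds its value at other close pairs, and
  -- this ratio is the eventual lower bound for the operator norm.
  let k₀ : X → X → ℝ := fun x y => if x ∈ F ∧ y ∈ F then
    (if x = y then 1 - ε / 4 else if dist x y ≤ R then 1 - ε / 2 else 0) else 0
  have hk₀F : ∀ x y, k₀ x y ≠ 0 → x ∈ F ∧ y ∈ F := by
    intro x y h
    by_contra hn
    exact h (if_neg hn)
  have hmem : ∀ k : X → X → ℝ, (∀ x, k x x = k₀ x x) →
      (∀ x y, dist x y ≤ R → k₀ x y ≤ k x y) → k ∈ nearOneKernels F R ε := by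
    intro k h1 h2
    refine ⟨fun x hx => ?_, fun x hx y hy hxy => ?_⟩
    · rw [h1 x]
      simp only [k₀, hx, and_self, if_true]
      constructor <;> linarith
    · refine lt_of_lt_of_le ?_ (h2 x y hxy)
      simp only [k₀, hx, hy, and_self, if_true, hxy]
      split_ifs <;> linarith
  have hk₀ : f k₀ < 0 :=
    (hfu k₀ (hmem k₀ (fun _ => rfl) fun _ _ _ => le_rfl)).trans_le hu
  have hshift : ∀ (x y : X) (s : ℝ), x ≠ y → (dist x y ≤ R → 0 ≤ s) → s * b x y ≤ 0 := by
    intro x y s hxy hs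
    by_contra! hn
    have h1 : ∀ t : ℝ, 0 ≤ t → f k₀ + t * (s * b x y) < u := by
      intro t ht
      let e : X → X → ℝ := Pi.single x (Pi.single y 1)
      have h2 : f (k₀ + (t * s) • e) = f k₀ + t * (s * b x y) := by
        rw [map_add, map_smul, smul_eq_mul, mul_assoc, hb]
      rw [← h2]
      refine hfu _ (hmem _ (fun a => ?_) fun a c hac => ?_)
      · by_cases ha : a = x
        · subst ha
          simp [e, hxy]
        · simp [e, Pi.single_eq_of_ne ha]
      · by_cases ha : a = x
        · subst ha
          by_cases hc : c = y
          · subst hc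
            have := mul_nonneg ht (hs hac)
            simpa [e] using this
          · simp [e, Pi.single_eq_of_ne hc]
        · simp [e, Pi.single_eq_of_ne ha]
    have h3 := h1 ((u - f k₀) / (s * b x y)) (div_nonneg
      (sub_nonneg.2 (by simpa using (h1 0 le_rfl).le)) hn.le)
    rw [div_mul_cancel₀ _ hn.ne'] at h3
    linarith
  have hb1 : ∀ x y, x ≠ y → b x y ≤ 0 := fun x y hxy => by
    simpa using hshift x y 1 hxy fun _ => zero_le_one
  have hb2 : ∀ x y, x ≠ y → R < dist x y → b x y = 0 := fun x y hxy hd => by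
    have := hshift x y (-1) hxy fun h => absurd h (not_le.2 hd)
    exact le_antisymm (hb1 x y hxy) (by linarith)
  refine ⟨b, hpos, hb1, hb2, ?_⟩
  rw [hsum k₀ hk₀F] at hk₀
  refine lt_of_eq_of_lt (Finset.sum_congr rfl fun x hx => Finset.sum_congr rfl fun y hy => ?_) hk₀
  simp only [k₀, hx, hy, and_self, if_true]

/-- The diagonal of the separating matrix becomes a measure and minus its off-diagonal part,
symmetrised, the weights. The form of `w` is at most that of `m` on localised functions, but exceeds
it by a factor more than 1 on the constant function. -/
theorem exists_separating_weights {F : Finset X} {R S ε : ℝ} (hS : 0 ≤ S)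
    (hε : 0 < ε)
    (hdis : Disjoint (nearOneKernels F R ε) (localizedCone F S : Set (X → X → ℝ))) :
    ∃ (m : X → ℝ) (w : X → X → ℝ), (∀ x ∈ F, 0 < m x) ∧ (∀ x y, 0 ≤ w x y) ∧
      (∀ x y, w x y = w y x) ∧ (∀ x y, w x y ≠ 0 → dist x y ≤ R) ∧
      (∀ ξ, IsLocalized F S ξ →
        ∑ x ∈ F, ∑ y ∈ F, w x y * (ξ x * ξ y) ≤ ∑ x ∈ F, m x * ξ x ^ 2) ∧
      (1 - ε / 4) * ∑ x ∈ F, m x < (1 - ε / 2) * ∑ x ∈ F, ∑ y ∈ F, w x y := by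
  classical
  obtain ⟨b, hpos, hb1, hb2, hk₀⟩ := exists_separating_matrix hε hdis
  obtain ⟨v, hv⟩ : ∃ v : X → X → ℝ, ∀ x y, v x y = if x = y then 0 else -b x y :=
    ⟨_, fun _ _ => rfl⟩
  have hv0 : ∀ x y, 0 ≤ v x y := by
    intro x y
    rw [hv]
    split_ifs with h
    · exact le_rfl
    · linarith [hb1 x y h]
  have hvR : ∀ x y, R < dist x y → v x y = 0 := by
    intro x y h
    rw [hv]
    split_ifs with h'
    · rfl
    · rw [hb2 x y h' h, neg_zero]
  have hbv : ∀ k : X → X → ℝ, ∑ x ∈ F, ∑ y ∈ F, b x y * k x y =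
      ∑ x ∈ F, b x x * k x x - ∑ x ∈ F, ∑ y ∈ F, v x y * k x y := by
    intro k
    rw [← Finset.sum_sub_distrib]
    refine Finset.sum_congr rfl fun x hx => ?_
    have h1 : ∀ y, b x y * k x y = (if x = y then b x x * k x x else 0) - v x y * k x y := by
      intro y
      rw [hv]
      split_ifs with h
      · subst h
        ring
      · ring
    rw [Finset.sum_congr rfl fun y _ => h1 y, Finset.sum_sub_distrib, Finset.sum_ite_eq, if_pos hx]
  obtain ⟨w, hw⟩ : ∃ w : X → X → ℝ, ∀ x y, w x y = (v x y + v y x) / 2 := ⟨_, fun _ _ => rfl⟩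
  have hwv : ∀ k : X → X → ℝ, (∀ x y, k x y = k y x) →
      ∑ x ∈ F, ∑ y ∈ F, w x y * k x y = ∑ x ∈ F, ∑ y ∈ F, v x y * k x y := by
    intro k hk
    have h1 : ∑ x ∈ F, ∑ y ∈ F, v y x * k x y = ∑ x ∈ F, ∑ y ∈ F, v x y * k x y := by
      rw [Finset.sum_comm]
      exact Finset.sum_congr rfl fun x _ => Finset.sum_congr rfl fun y _ => by rw [hk]
    have h2 : ∀ x y, w x y * k x y = (v x y * k x y + v y x * k x y) / 2 := by
      intro x y
      rw [hw]
      ring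
    simp only [h2, ← Finset.sum_div, Finset.sum_add_distrib]
    rw [h1]
    ring
  have hgap : (1 - ε / 4) * ∑ x ∈ F, b x x < (1 - ε / 2) * ∑ x ∈ F, ∑ y ∈ F, w x y := by
    have h1 := hk₀
    rw [hbv] at h1
    have h2 : ∑ x ∈ F, b x x * (if x = x then 1 - ε / 4 else if dist x x ≤ R then 1 - ε / 2 else 0) = (1 - ε / 4) * ∑ x ∈ F, b x x := by
      rw [Finset.mul_sum]
      refine Finset.sum_congr rfl fun x hx => ?_
      rw [if_pos rfl, mul_comm]
    have h3 : ∑ x ∈ F, ∑ y ∈ F, v x y *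
        (if x = y then 1 - ε / 4 else if dist x y ≤ R then 1 - ε / 2 else 0) = (1 - ε / 2) * ∑ x ∈ F, ∑ y ∈ F, v x y := by
      rw [Finset.mul_sum]
      refine Finset.sum_congr rfl fun x hx => ?_
      rw [Finset.mul_sum]
      refine Finset.sum_congr rfl fun y hy => ?_
      split_ifs with h4 h5
      · simp [hv, h4]
      · ring
      · rw [hvR x y (not_le.1 h5)]
        ring
    have h4 : ∑ x ∈ F, ∑ y ∈ F, w x y = ∑ x ∈ F, ∑ y ∈ F, v x y := by
      have := hwv (fun _ _ => 1) fun _ _ => rfl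
      simpa only [mul_one] using this
    rw [h4]
    linarith
  have hdiag : ∀ x ∈ F, 0 ≤ b x x := by
    intro x hx
    have h1 := hpos (Pi.single x 1) ⟨fun y hy => ?_, fun y z hy hz => ?_⟩
    · rw [Finset.sum_eq_single_of_mem x hx, Finset.sum_eq_single_of_mem x hx] at h1
      · simpa using h1
      · intro y _ hy
        simp [Pi.single_eq_of_ne hy]
      · intro y _ hy
        simp [Pi.single_eq_of_ne hy]
    · by_contra hn
      exact hy (Pi.single_eq_of_ne (by rintro rfl; exact hn hx) _)
    · have h2 : ∀ y, (Pi.single x (1 : ℝ) : X → ℝ) y ≠ 0 → y = x := fun y hy => by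
        by_contra hn
        exact hy (Pi.single_eq_of_ne hn _)
      rw [h2 y hy, h2 z hz, dist_self]
      exact hS
  obtain ⟨g, hg⟩ : ∃ g, g = (1 - ε / 2) * ∑ x ∈ F, ∑ y ∈ F, w x y -
      (1 - ε / 4) * ∑ x ∈ F, b x x := ⟨_, rfl⟩
  have hg0 : 0 < g := hg ▸ sub_pos.2 hgap
  -- Diagonal entries may vanish; adding `δ` makes the masses positive, and `F.card * δ < g`
  -- preserves the strict gap.
  obtain ⟨δ, hδ⟩ : ∃ δ, δ = g / (F.card + 1) := ⟨_, rfl⟩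
  have hδ0 : 0 < δ := hδ ▸ div_pos hg0 (Nat.cast_add_one_pos F.card)
  refine ⟨fun x => b x x + δ, w, fun x hx => by linarith [hdiag x hx], fun x y => ?_,
    fun x y => ?_, fun x y h => ?_, fun ξ hξ => ?_, ?_⟩
  · rw [hw]
    have := hv0 x y
    have := hv0 y x
    positivity
  · rw [hw, hw, add_comm]
  · by_contra hn
    exact h (by rw [hw, hvR x y (not_le.1 hn), hvR y x (by rw [dist_comm]; exact not_le.1 hn),
      add_zero, zero_div])
  · rw [hwv _ fun x y => mul_comm _ _]
    have h1 := hpos ξ hξ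
    rw [hbv] at h1
    have h2 : ∑ x ∈ F, b x x * (ξ x * ξ x) ≤ ∑ x ∈ F, (b x x + δ) * ξ x ^ 2 := by
      refine Finset.sum_le_sum fun x _ => ?_
      rw [← sq]
      exact mul_le_mul_of_nonneg_right (by linarith) (sq_nonneg _)
    linarith
  · rw [Finset.sum_add_distrib, Finset.sum_const, nsmul_eq_mul, mul_add]
    have h1 : (F.card : ℝ) * δ < g := by
      have : (F.card + 1 : ℝ) * δ = g := by
        rw [hδ]
        field_simp
      linarith
    have h2 : (1 - ε / 4) * (F.card * δ) ≤ F.card * δ := by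
      have : 0 ≤ (F.card : ℝ) * δ := by positivity
      nlinarith
    linarith

end CoarseGeom

/-! ### The operator of a finite kernel. -/

namespace CoarseGeom

variable {X : Type*} [MetricSpace X] [MeasurableSpace X] [Countable X] [MeasurableSingletonClass X]
  {H : Type*} [NormedAddCommGroup H] [InnerProductSpace ℂ H] {ν : Measure X}

theorem norm_apply_le (f : Lp H 2 ν) (hν : ∀ x, ν {x} ≠ ⊤) {x : X} (hx : ν {x} ≠ 0) :
    ‖f x‖ ≤ (√(ν.real {x}))⁻¹ * ‖f‖ := by
  have hpos : 0 < ν.real {x} := ENNReal.toReal_pos hx (hν x)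
  have h1 : ν.real {x} * ‖f x‖ ^ 2 ≤ ‖f‖ ^ 2 := by
    simpa using sum_le_lp_norm_sq f {x}
  have h2 := Real.sqrt_le_sqrt h1
  rw [Real.sqrt_mul hpos.le, Real.sqrt_sq (norm_nonneg _), Real.sqrt_sq (norm_nonneg _)] at h2
  rw [inv_mul_eq_div, le_div_iff₀ (Real.sqrt_pos.2 hpos), mul_comm]
  exact h2

/-- Evaluation at a point of positive measure, as a bounded operator. -/
noncomputable def evalCLM (hν : ∀ x, ν {x} ≠ ⊤) {x : X} (hx : ν {x} ≠ 0) : Lp H 2 ν →L[ℂ] H :=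
  (evalAt hx).mkContinuous _ fun f => norm_apply_le f hν hx

/-- The embedding of `H` at the point `x`, as a bounded operator. -/
noncomputable def atomCLM (hν : ∀ x, ν {x} ≠ ⊤) (x : X) : H →L[ℂ] Lp H 2 ν :=
  LinearMap.mkContinuous
    { toFun := atom hν x
      map_add' := fun v w => by
        refine lp_ext_atoms fun y hy => ?_
        have : (atom hν x v + atom hν x w : Lp H 2 ν) y = atom hν x v y + atom hν x w y :=
          map_add (evalAt hy) _ _
        rw [this]
        by_cases hxy : y = x
        · subst hxy
          simp only [atom_apply_self hν hy]
        · simp only [atom_apply_of_ne hν hy hxy, add_zero]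
      map_smul' := fun c v => by
        refine lp_ext_atoms fun y hy => ?_
        have : (c • atom hν x v : Lp H 2 ν) y = c • atom hν x v y := map_smul (evalAt hy) c _
        rw [RingHom.id_apply, this]
        by_cases hxy : y = x
        · subst hxy
          simp only [atom_apply_self hν hy]
        · simp only [atom_apply_of_ne hν hy hxy, smul_zero] }
    (√(ν.real {x})) fun v => by
      have h := congrArg Real.sqrt (norm_sq_atom hν x v)
      rw [Real.sqrt_sq (norm_nonneg _), Real.sqrt_mul measureReal_nonneg,
        Real.sqrt_sq (norm_nonneg _)] at h
      exact h.le

open Classical in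
/-- The operator `ζ ↦ (x ↦ ν{x}⁻¹ ∑ y, w x y ζ(y))`. -/
noncomputable def kernelOp (hν : ∀ x, ν {x} ≠ ⊤) (F : Finset X) (w : X → X → ℝ) :
    Lp H 2 ν →L[ℂ] Lp H 2 ν :=
  ∑ x ∈ F, ∑ y ∈ F, ((w x y / ν.real {x} : ℝ) : ℂ) •
    if hy : ν {y} ≠ 0 then atomCLM hν x ∘L evalCLM hν hy else 0

theorem kernelOp_apply (hν : ∀ x, ν {x} ≠ ⊤) {F : Finset X} (hF : ∀ x, x ∈ F ↔ ν {x} ≠ 0)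
    (w : X → X → ℝ) (ζ : Lp H 2 ν) {x : X} (hx : ν {x} ≠ 0) :
    kernelOp hν F w ζ x = ∑ y ∈ F, ((w x y / ν.real {x} : ℝ) : ℂ) • ζ y := by
  classical
  have h1 : ∀ x' ∈ F, ∀ y ∈ F, evalAt (H := H) hx ((((w x' y / ν.real {x'} : ℝ) : ℂ) •
      if hy : ν {y} ≠ 0 then atomCLM hν x' ∘L evalCLM hν hy else 0 : Lp H 2 ν →L[ℂ] Lp H 2 ν) ζ) =
      if x = x' then ((w x y / ν.real {x} : ℝ) : ℂ) • ζ y else 0 := by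
    intro x' _ y hy
    rw [dif_pos ((hF y).1 hy), smul_apply, map_smul]
    have h2 : evalAt hx ((atomCLM hν x' ∘L evalCLM hν ((hF y).1 hy)) ζ) = atom hν x' (ζ y) x := rfl
    rw [h2]
    split_ifs with h
    · subst h
      rw [atom_apply_self hν hx]
    · rw [atom_apply_of_ne hν hx h, smul_zero]
  have h3 : kernelOp hν F w ζ x = evalAt hx (kernelOp hν F w ζ) := rfl
  rw [h3, kernelOp, sum_apply, map_sum]
  have h4 : ∀ x' ∈ F, evalAt (H := H) hx ((∑ y ∈ F, ((w x' y / ν.real {x'} : ℝ) : ℂ) •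
      if hy : ν {y} ≠ 0 then atomCLM hν x' ∘L evalCLM hν hy else 0 : Lp H 2 ν →L[ℂ] Lp H 2 ν) ζ) =
      if x = x' then ∑ y ∈ F, ((w x y / ν.real {x} : ℝ) : ℂ) • ζ y else 0 := by
    intro x' hx'
    rw [sum_apply, map_sum, Finset.sum_congr rfl (h1 x' hx')]
    split_ifs <;> simp
  rw [Finset.sum_congr rfl h4, Finset.sum_ite_eq, if_pos ((hF x).2 hx)]

theorem lp_inner_eq_sum {F : Finset X} (hF : ∀ x, x ∈ F ↔ ν {x} ≠ 0) (f g : Lp H 2 ν) :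
    inner ℂ f g = ∑ x ∈ F, ((ν.real {x} : ℝ) : ℂ) * inner ℂ (f x) (g x) := by
  rw [L2.inner_def, integral_countable (L2.integrable_inner f g)]
  rw [tsum_eq_sum (s := F)]
  · simp
  · intro x hx
    have : ν {x} = 0 := by
      by_contra h
      exact hx ((hF x).2 h)
    simp [Measure.real, this]

/-- The factor `ν{x}⁻¹` in `kernelOp` cancels the weight of the inner product, so the form is `w`
itself; symmetry of `w` then gives self-adjointness. -/
theorem inner_kernelOp (hν : ∀ x, ν {x} ≠ ⊤) {F : Finset X} (hF : ∀ x, x ∈ F ↔ ν {x} ≠ 0)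
    (w : X → X → ℝ) (f g : Lp H 2 ν) :
    inner ℂ f (kernelOp hν F w g) = ∑ x ∈ F, ∑ y ∈ F, ((w x y : ℝ) : ℂ) * inner ℂ (f x) (g y) := by
  rw [lp_inner_eq_sum hF]
  refine Finset.sum_congr rfl fun x hx => ?_
  have hx0 := (hF x).1 hx
  have hpos : (ν.real {x} : ℂ) ≠ 0 := by
    exact_mod_cast (ENNReal.toReal_pos hx0 (hν x)).ne'
  rw [kernelOp_apply hν hF w g hx0, inner_sum, Finset.mul_sum]
  refine Finset.sum_congr rfl fun y _ => ?_
  rw [inner_smul_right, ← mul_assoc]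
  congr 1
  push_cast
  field_simp

theorem isSelfAdjoint_kernelOp [CompleteSpace H] (hν : ∀ x, ν {x} ≠ ⊤) {F : Finset X}
    (hF : ∀ x, x ∈ F ↔ ν {x} ≠ 0) {w : X → X → ℝ} (hw : ∀ x y, w x y = w y x) :
    IsSelfAdjoint (kernelOp hν F w : Lp H 2 ν →L[ℂ] Lp H 2 ν) := by
  rw [ContinuousLinearMap.isSelfAdjoint_iff_isSymmetric]
  intro f g
  change inner ℂ (kernelOp hν F w f) g = inner ℂ f (kernelOp hν F w g)
  rw [← inner_conj_symm, inner_kernelOp hν hF, inner_kernelOp hν hF, map_sum, Finset.sum_comm]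
  simp_rw [map_sum, map_mul, Complex.conj_ofReal, inner_conj_symm]
  refine Finset.sum_congr rfl fun x _ => Finset.sum_congr rfl fun y _ => ?_
  rw [hw]

end CoarseGeom

/-! ### Global and local norms of the kernel operator. -/

namespace CoarseGeom

variable {X : Type*} [MetricSpace X] [MeasurableSpace X] [Countable X] [MeasurableSingletonClass X]
  {H : Type*} [NormedAddCommGroup H] [InnerProductSpace ℂ H] {ν : Measure X}

/-- Test against the vector that is a constant unit vector on `F`. -/
theorem le_opNorm_kernelOp [Nontrivial H] (hν : ∀ x, ν {x} ≠ ⊤) {F : Finset X}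
    (hF : ∀ x, x ∈ F ↔ ν {x} ≠ 0) {w : X → X → ℝ} :
    ∑ x ∈ F, ∑ y ∈ F, w x y ≤
      ‖(kernelOp hν F w : Lp H 2 ν →L[ℂ] Lp H 2 ν)‖ * ∑ x ∈ F, ν.real {x} := by
  classical
  obtain ⟨e, he⟩ := exists_norm_eq H zero_le_one
  set η : Lp H 2 ν := ∑ x ∈ F, atom hν x e with hη
  have hηx : ∀ x ∈ F, η x = e := fun x hx => by
    rw [hη, sum_atom_apply hν F (fun _ => e) ((hF x).1 hx), if_pos hx]
  have hηn : ‖η‖ ^ 2 = ∑ x ∈ F, ν.real {x} := by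
    rw [hη, norm_sq_sum_atom hν F fun _ => e, he]
    simp
  have h1 : inner ℂ η (kernelOp hν F w η) = ((∑ x ∈ F, ∑ y ∈ F, w x y : ℝ) : ℂ) := by
    rw [inner_kernelOp hν hF]
    push_cast
    refine Finset.sum_congr rfl fun x hx => Finset.sum_congr rfl fun y hy => ?_
    rw [hηx x hx, hηx y hy, inner_self_eq_norm_sq_to_K, he]
    simp
  have h2 := norm_inner_le_norm (𝕜 := ℂ) η (kernelOp hν F w η)
  rw [h1, Complex.norm_real] at h2
  rw [← hηn]
  calc ∑ x ∈ F, ∑ y ∈ F, w x y ≤ ‖∑ x ∈ F, ∑ y ∈ F, w x y‖ := Real.le_norm_self _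
    _ ≤ ‖η‖ * ‖kernelOp hν F w η‖ := h2
    _ ≤ ‖η‖ * (‖(kernelOp hν F w : Lp H 2 ν →L[ℂ] Lp H 2 ν)‖ * ‖η‖) :=
      mul_le_mul_of_nonneg_left (ContinuousLinearMap.le_opNorm _ _) (norm_nonneg _)
    _ = _ := by ring

theorem lpSupport_kernelOp_subset (hν : ∀ x, ν {x} ≠ ⊤) {F : Finset X}
    (hF : ∀ x, x ∈ F ↔ ν {x} ≠ 0) {w : X → X → ℝ} {R : ℝ} (hw : ∀ x y, w x y ≠ 0 → dist x y ≤ R)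
    (ζ : Lp H 2 ν) :
    lpSupport (kernelOp hν F w ζ) ⊆ {x | ∃ y ∈ lpSupport ζ, dist x y ≤ R} := by
  rintro x ⟨hx, hx'⟩
  rw [kernelOp_apply hν hF w ζ hx] at hx'
  obtain ⟨y, hy, hne⟩ := Finset.exists_ne_zero_of_sum_ne_zero hx'
  refine ⟨y, ⟨(hF y).1 hy, right_ne_zero_of_smul hne⟩, hw x y fun h0 => hne ?_⟩
  simp [h0]

theorem lpSupport_kernelOp_pow_subset (hν : ∀ x, ν {x} ≠ ⊤) {F : Finset X}
    (hF : ∀ x, x ∈ F ↔ ν {x} ≠ 0) {w : X → X → ℝ} {R : ℝ} (hw : ∀ x y, w x y ≠ 0 → dist x y ≤ R)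
    (ζ : Lp H 2 ν) (n : ℕ) :
    lpSupport ((kernelOp hν F w ^ n) ζ) ⊆ {x | ∃ y ∈ lpSupport ζ, dist x y ≤ n * R} := by
  induction n with
  | zero =>
    intro x hx
    exact ⟨x, by simpa using hx, by simp⟩
  | succ n ih =>
    intro x hx
    rw [pow_succ'] at hx
    obtain ⟨y, hy, hxy⟩ := lpSupport_kernelOp_subset hν hF hw _ hx
    obtain ⟨z, hz, hyz⟩ := ih hy
    refine ⟨z, hz, ?_⟩
    push_cast
    linarith [dist_triangle x y z]

theorem propagationLE_kernelOp_pow (hν : ∀ x, ν {x} ≠ ⊤) {F : Finset X}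
    (hF : ∀ x, x ∈ F ↔ ν {x} ≠ 0) {w : X → X → ℝ} {R : ℝ} (hw : ∀ x y, w x y ≠ 0 → dist x y ≤ R)
    (n : ℕ) : PropagationLE (kernelOp hν F w ^ n : Lp H 2 ν →L[ℂ] Lp H 2 ν) (n * R) := by
  rintro ⟨x, y⟩ ⟨ζ, hζ, hx⟩
  obtain ⟨z, hz, hxz⟩ := lpSupport_kernelOp_pow_subset hν hF hw ζ n hx
  have : z = y := hζ hz
  rwa [this] at hxz

/-- Polarisation of the local bound for a non-negative symmetric kernel. -/
theorem two_mul_form_le {F : Finset X} {S : ℝ} {m : X → ℝ} {w : X → X → ℝ}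
    (hw0 : ∀ x y, 0 ≤ w x y) (hws : ∀ x y, w x y = w y x)
    (hloc : ∀ ξ, IsLocalized F S ξ →
      ∑ x ∈ F, ∑ y ∈ F, w x y * (ξ x * ξ y) ≤ ∑ x ∈ F, m x * ξ x ^ 2)
    {ξ θ : X → ℝ} {B : Set X} (hB : ∀ x ∈ B, ∀ y ∈ B, dist x y ≤ S)
    (hξ : ∀ x, ξ x ≠ 0 → x ∈ F ∧ x ∈ B) (hθ : ∀ x, θ x ≠ 0 → x ∈ F ∧ x ∈ B) :
    2 * ∑ x ∈ F, ∑ y ∈ F, w x y * (θ x * ξ y) ≤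
      ∑ x ∈ F, m x * ξ x ^ 2 + ∑ x ∈ F, m x * θ x ^ 2 := by
  have hne : ∀ (φ : X → ℝ), (∀ x, ξ x = 0 → θ x = 0 → φ x = 0) → IsLocalized F S φ := by
    intro φ hφ
    have h1 : ∀ x, φ x ≠ 0 → x ∈ F ∧ x ∈ B := by
      intro x hx
      by_cases h2 : ξ x = 0
      · exact hθ x fun h3 => hx (hφ x h2 h3)
      · exact hξ x h2
    exact ⟨fun x hx => (h1 x hx).1, fun x y hx hy => hB x (h1 x hx).2 y (h1 y hy).2⟩
  have h1 := hloc (fun x => ξ x + θ x) (hne _ fun x h2 h3 => by simp [h2, h3])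
  -- Polarisation needs a lower bound for the form at `ξ - θ`; since `w ≥ 0`, minus that value is at
  -- most the form at `|ξ - θ|`.
  have h2 := hloc (fun x => |ξ x - θ x|) (hne _ fun x h2 h3 => by simp [h2, h3])
  have h3 : -∑ x ∈ F, ∑ y ∈ F, w x y * ((ξ x - θ x) * (ξ y - θ y)) ≤
      ∑ x ∈ F, ∑ y ∈ F, w x y * (|ξ x - θ x| * |ξ y - θ y|) := by
    simp_rw [← Finset.sum_neg_distrib]
    refine Finset.sum_le_sum fun x _ => Finset.sum_le_sum fun y _ => ?_
    rw [← abs_mul, ← mul_neg]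
    exact mul_le_mul_of_nonneg_left (neg_le_abs _) (hw0 x y)
  have h4 : ∑ x ∈ F, ∑ y ∈ F, w x y * ((ξ x + θ x) * (ξ y + θ y)) -
      ∑ x ∈ F, ∑ y ∈ F, w x y * ((ξ x - θ x) * (ξ y - θ y)) =
      4 * ∑ x ∈ F, ∑ y ∈ F, w x y * (θ x * ξ y) := by
    have h5 : ∑ x ∈ F, ∑ y ∈ F, w x y * (ξ x * θ y) =
        ∑ x ∈ F, ∑ y ∈ F, w x y * (θ x * ξ y) := by
      rw [Finset.sum_comm]
      refine Finset.sum_congr rfl fun x _ => Finset.sum_congr rfl fun y _ => ?_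
      rw [hws, mul_comm (ξ y)]
    have h6 : ∀ x y, w x y * ((ξ x + θ x) * (ξ y + θ y)) - w x y * ((ξ x - θ x) * (ξ y - θ y)) =
        2 * (w x y * (ξ x * θ y)) + 2 * (w x y * (θ x * ξ y)) := by
      intro x y
      ring
    simp_rw [← Finset.sum_sub_distrib, h6, Finset.sum_add_distrib, ← Finset.mul_sum]
    rw [h5]
    ring
  have h7 : ∑ x ∈ F, m x * (ξ x + θ x) ^ 2 + ∑ x ∈ F, m x * |ξ x - θ x| ^ 2 =
      2 * (∑ x ∈ F, m x * ξ x ^ 2 + ∑ x ∈ F, m x * θ x ^ 2) := by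
    rw [← Finset.sum_add_distrib, ← Finset.sum_add_distrib, Finset.mul_sum]
    refine Finset.sum_congr rfl fun x _ => ?_
    rw [sq_abs]
    ring
  linarith

/-- As `w ≥ 0`, vectors may be replaced by their pointwise norms. Writing A for the operator, the
polarised bound gives 2‖Aζ‖² ≤ ‖ζ‖² + ‖Aζ‖². -/
theorem norm_kernelOp_apply_le (hν : ∀ x, ν {x} ≠ ⊤) {F : Finset X}
    (hF : ∀ x, x ∈ F ↔ ν {x} ≠ 0) {S : ℝ} {w : X → X → ℝ}
    (hw0 : ∀ x y, 0 ≤ w x y) (hws : ∀ x y, w x y = w y x)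
    (hloc : ∀ ξ, IsLocalized F S ξ →
      ∑ x ∈ F, ∑ y ∈ F, w x y * (ξ x * ξ y) ≤ ∑ x ∈ F, ν.real {x} * ξ x ^ 2)
    {ζ : Lp H 2 ν} {B : Set X} (hB : ∀ x ∈ B, ∀ y ∈ B, dist x y ≤ S)
    (hζ : lpSupport ζ ⊆ B) (hζ' : lpSupport (kernelOp hν F w ζ) ⊆ B) :
    ‖kernelOp hν F w ζ‖ ≤ ‖ζ‖ := by
  classical
  let nrm : Lp H 2 ν → X → ℝ := fun f x => if x ∈ F then ‖f x‖ else 0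
  have hnrm : ∀ f : Lp H 2 ν, lpSupport f ⊆ B → ∀ x, nrm f x ≠ 0 → x ∈ F ∧ x ∈ B := by
    intro f hf x hx
    have hxF : x ∈ F := by
      by_contra hn
      exact hx (if_neg hn)
    simp only [nrm, if_pos hxF] at hx
    exact ⟨hxF, hf ⟨(hF x).1 hxF, norm_ne_zero_iff.1 hx⟩⟩
  have hsq : ∀ f : Lp H 2 ν, ‖f‖ ^ 2 = ∑ x ∈ F, ν.real {x} * nrm f x ^ 2 := by
    intro f
    rw [lp_norm_sq_eq_sum (F := F) fun x hx hxF => absurd ((hF x).2 hx) hxF]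
    exact Finset.sum_congr rfl fun x hx => by simp only [nrm, if_pos hx]
  have h1 := two_mul_form_le hw0 hws hloc hB (hnrm ζ hζ) (hnrm _ hζ')
  rw [← hsq, ← hsq] at h1
  have h2 : ‖kernelOp hν F w ζ‖ ^ 2 ≤
      ∑ x ∈ F, ∑ y ∈ F, w x y * (nrm (kernelOp hν F w ζ) x * nrm ζ y) := by
    rw [hsq]
    refine Finset.sum_le_sum fun x hx => ?_
    have hx0 := (hF x).1 hx
    have hpos : 0 < ν.real {x} := ENNReal.toReal_pos hx0 (hν x)
    have h3 : ν.real {x} * nrm (kernelOp hν F w ζ) x ≤ ∑ y ∈ F, w x y * nrm ζ y := by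
      simp only [nrm, if_pos hx]
      rw [kernelOp_apply hν hF w ζ hx0]
      refine (mul_le_mul_of_nonneg_left (norm_sum_le _ _) hpos.le).trans ?_
      rw [Finset.mul_sum]
      refine Finset.sum_le_sum fun y hy => le_of_eq ?_
      rw [if_pos hy, norm_smul, Complex.norm_real, Real.norm_eq_abs,
        abs_of_nonneg (div_nonneg (hw0 x y) hpos.le)]
      field_simp
    have h4 : 0 ≤ nrm (kernelOp hν F w ζ) x := by
      simp only [nrm, if_pos hx]
      exact norm_nonneg _
    calc ν.real {x} * nrm (kernelOp hν F w ζ) x ^ 2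
        = ν.real {x} * nrm (kernelOp hν F w ζ) x * nrm (kernelOp hν F w ζ) x := by ring
      _ ≤ (∑ y ∈ F, w x y * nrm ζ y) * nrm (kernelOp hν F w ζ) x :=
        mul_le_mul_of_nonneg_right h3 h4
      _ = _ := by
        rw [Finset.sum_mul]
        exact Finset.sum_congr rfl fun y _ => by ring
  refine (pow_le_pow_iff_left₀ (norm_nonneg _) (norm_nonneg _) two_ne_zero).1 ?_
  linarith

/-- All iterates up to `n` stay in the `n * R`-neighbourhood of the support of `ζ`, of diameter at
most `S + 2 * (n * R)`, where each application does not increase the norm. -/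
theorem norm_kernelOp_pow_apply_le (hν : ∀ x, ν {x} ≠ ⊤) {F : Finset X}
    (hF : ∀ x, x ∈ F ↔ ν {x} ≠ 0) {R S : ℝ} (hR : 0 ≤ R) {w : X → X → ℝ}
    (hw0 : ∀ x y, 0 ≤ w x y) (hws : ∀ x y, w x y = w y x)
    (hw : ∀ x y, w x y ≠ 0 → dist x y ≤ R) {n : ℕ}
    (hloc : ∀ ξ, IsLocalized F (S + 2 * (n * R)) ξ →
      ∑ x ∈ F, ∑ y ∈ F, w x y * (ξ x * ξ y) ≤ ∑ x ∈ F, ν.real {x} * ξ x ^ 2)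
    {ζ : Lp H 2 ν} (hζ : ∀ x ∈ lpSupport ζ, ∀ y ∈ lpSupport ζ, dist x y ≤ S) :
    ‖(kernelOp hν F w ^ n) ζ‖ ≤ ‖ζ‖ := by
  suffices H : ∀ k ≤ n, ‖(kernelOp hν F w ^ k) ζ‖ ≤ ‖ζ‖ from H n le_rfl
  have hsub : ∀ k ≤ n, lpSupport ((kernelOp hν F w ^ k) ζ) ⊆
      {x | ∃ y ∈ lpSupport ζ, dist x y ≤ n * R} := by
    intro k hk x hx
    obtain ⟨y, hy, hxy⟩ := lpSupport_kernelOp_pow_subset hν hF hw ζ k hx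
    refine ⟨y, hy, hxy.trans (mul_le_mul_of_nonneg_right ?_ hR)⟩
    exact_mod_cast hk
  intro k
  induction k with
  | zero => simp
  | succ k ih =>
    intro hk
    refine le_trans ?_ (ih (by omega))
    have h1 : (kernelOp hν F w ^ (k + 1)) ζ = kernelOp hν F w ((kernelOp hν F w ^ k) ζ) := by
      rw [pow_succ']
      rfl
    rw [h1]
    refine norm_kernelOp_apply_le hν hF hw0 hws hloc ?_ (hsub k (by omega))
      (by rw [← h1]; exact hsub (k + 1) hk)
    rintro x ⟨x', hx', hxx'⟩ y ⟨y', hy', hyy'⟩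
    have := dist_triangle4 x x' y' y
    rw [dist_comm y' y] at this
    linarith [hζ x' hx' y' hy']

end CoarseGeom

/-! ### Operator norm localisation gives Property A. -/

namespace CoarseGeom

/-- Operator norm localisation produces kernels of bounded width close to `1` near the diagonal. -/
theorem not_disjoint_of_localisation {X : Type*} [MetricSpace X] [MeasurableSpace X] [BorelSpace X]
    {H : Type*} [NormedAddCommGroup H] [InnerProductSpace ℂ H] [CompleteSpace H] [Nontrivial H]
    (hX : IsSpace X) {c R S ε : ℝ} (hc : 0 < c) (hR : 0 < R) (hS : 0 < S) (hε : 0 < ε)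
    (hε1 : ε < 1) {j : ℕ} (hj : 1 < c * ((1 - ε / 4) / (1 - ε / 2)) ^ 2 ^ j) {D : Set X}
    (hD : ∀ ν : Measure X, IsLocallyFiniteMeasure ν → ν ≠ 0 → ν.support ⊆ D →
      ∀ a : Lp H 2 ν →L[ℂ] Lp H 2 ν, PropagationLE a ((2 ^ j : ℕ) * R) →
        ∃ ζ : Lp H 2 ν, ζ ≠ 0 ∧ Metric.ediam (lpSupport ζ) ≤ ENNReal.ofReal S ∧
          c * ‖a‖ * ‖ζ‖ ≤ ‖a ζ‖)
    {F : Finset X} (hF : ∀ x ∈ F, x ∈ D) :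
    ¬ Disjoint (nearOneKernels F R ε)
      (localizedCone F (S + 2 * ((2 ^ j : ℕ) * R)) : Set (X → X → ℝ)) := by
  classical
  intro hdis
  have hcount := hX.countable
  obtain ⟨m, w, hm, hw0, hws, hwR, hloc, hgap⟩ :=
    exists_separating_weights (by positivity) hε hdis
  let ν : Measure X := ∑ x ∈ F, ENNReal.ofReal (m x) • Measure.dirac x
  have hνx : ∀ z, ν {z} = if z ∈ F then ENNReal.ofReal (m z) else 0 := by
    intro z
    have h1 : ∀ x, (ENNReal.ofReal (m x) • Measure.dirac x) {z} =
        if z = x then ENNReal.ofReal (m z) else 0 := by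
      intro x
      rw [Measure.smul_apply, Measure.dirac_apply]
      split_ifs with h
      · subst h
        simp
      · simp [Ne.symm h]
    simp only [ν, Measure.finsetSum_apply, h1, Finset.sum_ite_eq]
  have hFν : ∀ x, x ∈ F ↔ ν {x} ≠ 0 := by
    intro x
    rw [hνx]
    by_cases hx : x ∈ F
    · simpa [hx] using hm x hx
    · simp [hx]
  have hν : ∀ x, ν {x} ≠ ⊤ := by
    intro x
    rw [hνx]
    split_ifs <;> simp
  have hreal : ∀ x ∈ F, ν.real {x} = m x := by
    intro x hx
    rw [Measure.real, hνx, if_pos hx, ENNReal.toReal_ofReal (hm x hx).le]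
  have hne : F.Nonempty := by
    rw [Finset.nonempty_iff_ne_empty]
    rintro rfl
    simp at hgap
  have hsum : 0 < ∑ x ∈ F, m x := Finset.sum_pos hm hne
  have hν0 : ν ≠ 0 := by
    intro h
    obtain ⟨x, hx⟩ := hne
    exact (hFν x).1 hx (by simp [h])
  have hfin : IsFiniteMeasure ν := by
    refine ⟨?_⟩
    simp only [ν, Measure.finsetSum_apply, Measure.smul_apply, smul_eq_mul]
    exact ENNReal.sum_lt_top.2 fun x _ => by simp
  set A : Lp H 2 ν →L[ℂ] Lp H 2 ν := kernelOp hν F w with hA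
  obtain ⟨ζ, hζ0, hζS, hζ⟩ := hD ν inferInstance hν0
    (fun x hx => hF x ((hFν x).2 (hX.mem_support_iff.1 hx))) (A ^ 2 ^ j)
    (propagationLE_kernelOp_pow hν hFν hwR (2 ^ j))
  have hle : ‖(A ^ 2 ^ j) ζ‖ ≤ ‖ζ‖ := by
    refine norm_kernelOp_pow_apply_le hν hFν hR.le hw0 hws hwR (S := S) (fun ξ hξ => ?_) ?_
    · refine (hloc ξ hξ).trans_eq (Finset.sum_congr rfl fun x hx => ?_)
      rw [hreal x hx]
    · intro x hx y hy
      have h1 := (Metric.edist_le_ediam_of_mem hx hy).trans hζS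
      rw [edist_dist] at h1
      exact (ENNReal.ofReal_le_ofReal_iff hS.le).1 h1
  have hnorm : (1 - ε / 4) / (1 - ε / 2) ≤ ‖A‖ := by
    have h1 := le_opNorm_kernelOp (H := H) hν hFν (w := w)
    rw [Finset.sum_congr rfl hreal] at h1
    rw [div_le_iff₀ (by linarith)]
    have h2 : (1 - ε / 2) * ∑ x ∈ F, ∑ y ∈ F, w x y ≤ (1 - ε / 2) * (‖A‖ * ∑ x ∈ F, m x) :=
      mul_le_mul_of_nonneg_left h1 (by linarith)
    refine le_of_mul_le_mul_right ?_ hsum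
    linarith
  -- Self-adjointness makes the norm multiplicative on these powers, so the ratio above 1 is
  -- amplified until it beats `c`.
  have hpow : ‖A ^ 2 ^ j‖ = ‖A‖ ^ 2 ^ j :=
    (isSelfAdjoint_kernelOp hν hFν hws).norm_pow_two_pow j
  have hζpos : 0 < ‖ζ‖ := norm_pos_iff.2 hζ0
  have h1 : c * ((1 - ε / 4) / (1 - ε / 2)) ^ 2 ^ j ≤ c * ‖A ^ 2 ^ j‖ := by
    rw [hpow]
    refine mul_le_mul_of_nonneg_left (pow_le_pow_left₀ ?_ hnorm _) hc.le
    exact div_nonneg (by linarith) (by linarith)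
  have h2 : c * ‖A ^ 2 ^ j‖ * ‖ζ‖ ≤ 1 * ‖ζ‖ := by
    rw [one_mul]
    exact hζ.trans hle
  linarith [le_of_mul_le_mul_right h2 hζpos]

/-- Cauchy–Schwarz for |u - v||u + v|: with t the inner product, the bound is (2 - 2t)(2 + 2t), and
1 - ε ≤ t ≤ 1. -/
theorem sum_abs_sq_sub_sq_le {ι : Type*} (s : Finset ι) {u v : ι → ℝ} {ε : ℝ}
    (hu : ∑ i ∈ s, u i ^ 2 = 1) (hv : ∑ i ∈ s, v i ^ 2 = 1) (huv : 1 - ε ≤ ∑ i ∈ s, u i * v i) :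
    (∑ i ∈ s, |u i ^ 2 - v i ^ 2|) ^ 2 ≤ 8 * ε := by
  have h1 : ∀ i, |u i ^ 2 - v i ^ 2| = |u i - v i| * |u i + v i| := by
    intro i
    rw [← abs_mul]
    congr 1
    ring
  simp_rw [h1]
  have h2 := Finset.sum_mul_sq_le_sq_mul_sq s (fun i => |u i - v i|) (fun i => |u i + v i|)
  simp only [sq_abs] at h2
  have h3 : ∑ i ∈ s, (u i - v i) ^ 2 = 2 - 2 * ∑ i ∈ s, u i * v i := by
    simp_rw [sub_sq, Finset.sum_add_distrib, Finset.sum_sub_distrib, hu, hv, mul_assoc,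
      ← Finset.mul_sum]
    ring
  have h4 : ∑ i ∈ s, (u i + v i) ^ 2 = 2 + 2 * ∑ i ∈ s, u i * v i := by
    simp_rw [add_sq, Finset.sum_add_distrib, hu, hv, mul_assoc, ← Finset.mul_sum]
    ring
  have h5 : 0 ≤ ∑ i ∈ s, (u i - v i) ^ 2 := Finset.sum_nonneg fun i _ => sq_nonneg _
  have h6 : 0 ≤ ∑ i ∈ s, (u i + v i) ^ 2 := Finset.sum_nonneg fun i _ => sq_nonneg _
  rw [h3] at h5 h2
  rw [h4] at h6 h2
  nlinarith

variable {X : Type*} [MetricSpace X]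

/-- The vectors (ξ_i(x))_i have Gram kernel `k`. Once normalised, their squared coordinates are
probability weights on the indices; each index `i` is carried to a point `p i` within `S` of the
support of ξ_i. This push-forward does not increase ℓ¹ distances. -/
theorem exists_family_of_kernel (hX : IsSpace X) {F : Finset X} {R S ε δ : ℝ}
    (hε1 : ε < 1) (hδ : 0 ≤ δ) (hεδ : 8 * ε ≤ δ ^ 2) {k : X → X → ℝ}
    (hk : k ∈ nearOneKernels F R ε) (hk' : k ∈ localizedCone F S) :
    ∃ h : X → X → ℝ, (∀ x z, h x z ∈ Set.Icc (0 : ℝ) 1) ∧ (∀ x z, S < dist z x → h x z = 0) ∧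
      ∀ x ∈ F, ∑ z ∈ hX.cball x S, h x z = 1 ∧ ∀ y ∈ F, dist x y ≤ R →
        ∑ z ∈ hX.cball x (S + R), |h x z - h y z| ≤ δ := by
  classical
  rcases F.eq_empty_or_nonempty with rfl | ⟨x₀, hx₀⟩
  · exact ⟨0, by simp, by simp, by simp⟩
  obtain ⟨n, ξ, hξ, hkξ⟩ := exists_of_mem_localizedCone hk'
  have hpt : ∀ i, ∃ z, ∀ x, ξ i x ≠ 0 → dist z x ≤ S := by
    intro i
    by_cases hi : ∃ z, ξ i z ≠ 0
    · obtain ⟨z, hz⟩ := hi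
      exact ⟨z, fun x hx => (hξ i).2 z x hz hx⟩
    · exact ⟨x₀, fun x hx => absurd ⟨x, hx⟩ hi⟩
  choose p hp using hpt
  obtain ⟨u, hu⟩ : ∃ u : X → Fin n → ℝ, ∀ x i, u x i = ξ i x / √(k x x) := ⟨_, fun _ _ => rfl⟩
  have hu0 : ∀ x i, u x i ≠ 0 → ξ i x ≠ 0 := by
    intro x i h h0
    exact h (by rw [hu, h0, zero_div])
  have hkpos : ∀ x ∈ F, 0 < k x x := fun x hx => by linarith [(hk.1 x hx).1]
  have hinner : ∀ x ∈ F, ∀ y ∈ F, ∑ i, u x i * u y i = k x y / (√(k x x) * √(k y y)) := by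
    intro x _ y _
    rw [hkξ x y, Finset.sum_div]
    refine Finset.sum_congr rfl fun i _ => ?_
    rw [hu, hu, div_mul_div_comm]
  have hunit : ∀ x ∈ F, ∑ i, u x i ^ 2 = 1 := by
    intro x hx
    simp_rw [sq]
    rw [hinner x hx x hx, Real.mul_self_sqrt (hkpos x hx).le, div_self (hkpos x hx).ne']
  have huF : ∀ x ∉ F, ∀ i, u x i = 0 := by
    intro x hx i
    by_contra hn
    exact hx ((hξ i).1 x (hu0 x i hn))
  have hdist : ∀ x i, u x i ^ 2 ≠ 0 → dist (p i) x ≤ S := fun x i h =>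
    hp i x (hu0 x i fun h0 => h (by rw [h0]; ring))
  let h : X → X → ℝ := fun x z => ∑ i, if p i = z then u x i ^ 2 else 0
  have h0 : ∀ x z, 0 ≤ h x z := fun x z => Finset.sum_nonneg fun i _ => by
    split_ifs
    exacts [sq_nonneg _, le_rfl]
  refine ⟨h, fun x z => ⟨h0 x z, ?_⟩, fun x z hxz => ?_, fun x hx => ⟨?_, fun y hy hxy => ?_⟩⟩
  · by_cases hx : x ∈ F
    · rw [← hunit x hx]
      refine Finset.sum_le_sum fun i _ => ?_
      split_ifs
      exacts [le_rfl, sq_nonneg _]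
    · refine le_trans (le_of_eq (Finset.sum_eq_zero fun i _ => ?_)) zero_le_one
      simp [huF x hx i]
  · refine Finset.sum_eq_zero fun i _ => ?_
    split_ifs with hz
    · by_contra hne
      exact not_le.2 hxz (hz ▸ hdist x i hne)
    · rfl
  · rw [← hunit x hx, Finset.sum_comm]
    refine Finset.sum_congr rfl fun i _ => ?_
    rw [Finset.sum_ite_eq]
    split_ifs with hz
    · rfl
    · by_contra hne
      exact hz (hX.mem_cball.2 (hdist x i (Ne.symm hne)))
  -- The diagonal of `k` is below 1, so normalising keeps the inner product above `1 - ε`.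
  · have h1 : 1 - ε ≤ ∑ i, u x i * u y i := by
      rw [hinner x hx y hy, le_div_iff₀ (mul_pos (Real.sqrt_pos.2 (hkpos x hx))
        (Real.sqrt_pos.2 (hkpos y hy)))]
      have h2 : √(k x x) * √(k y y) ≤ 1 := mul_le_one₀ (Real.sqrt_le_one.2 (hk.1 x hx).2.le)
        (Real.sqrt_nonneg _) (Real.sqrt_le_one.2 (hk.1 y hy).2.le)
      nlinarith [hk.2 x hx y hy hxy]
    have h2 := sum_abs_sq_sub_sq_le Finset.univ (hunit x hx) (hunit y hy) h1
    have h3 : ∑ i, |u x i ^ 2 - u y i ^ 2| ≤ δ := by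
      refine (pow_le_pow_iff_left₀ (Finset.sum_nonneg fun i _ => abs_nonneg _) hδ two_ne_zero).1 ?_
      exact h2.trans hεδ
    refine le_trans ?_ h3
    have h4 : ∀ z, |h x z - h y z| ≤ ∑ i, if p i = z then |u x i ^ 2 - u y i ^ 2| else 0 := by
      intro z
      simp only [h]
      rw [← Finset.sum_sub_distrib]
      refine (Finset.abs_sum_le_sum_abs _ _).trans (Finset.sum_le_sum fun i _ => ?_)
      split_ifs <;> simp
    refine (Finset.sum_le_sum fun z _ => h4 z).trans ?_
    rw [Finset.sum_comm]
    refine Finset.sum_le_sum fun i _ => ?_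
    rw [Finset.sum_ite_eq]
    split_ifs
    exacts [le_rfl, abs_nonneg _]

/-- Families defined on the finite subsets of `D` have a limit family, defined on `D`. -/
theorem exists_family_of_finite (hX : IsSpace X) {D : Set X} {R S δ : ℝ}
    (hfin : ∀ F : Finset X, (∀ x ∈ F, x ∈ D) → ∃ h : X → X → ℝ,
      (∀ x z, h x z ∈ Set.Icc (0 : ℝ) 1) ∧ (∀ x z, S < dist z x → h x z = 0) ∧
      ∀ x ∈ F, ∑ z ∈ hX.cball x S, h x z = 1 ∧ ∀ y ∈ F, dist x y ≤ R →
        ∑ z ∈ hX.cball x (S + R), |h x z - h y z| ≤ δ) :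
    ∃ h : X → X → ℝ, (∀ x z, 0 ≤ h x z) ∧ (∀ x z, S < dist z x → h x z = 0) ∧
      ∀ x ∈ D, ∑ z ∈ hX.cball x S, h x z = 1 ∧ ∀ y ∈ D, dist x y ≤ R →
        ∑ z ∈ hX.cball x (S + R), |h x z - h y z| ≤ δ := by
  classical
  choose! h h01 hS hF using hfin
  let 𝒰 : Ultrafilter (Finset D) := Ultrafilter.of atTop
  let g : Finset D → X → X → ℝ := fun F => h (F.map (Function.Embedding.subtype _))
  have hFD : ∀ F : Finset D, ∀ x ∈ F.map (Function.Embedding.subtype (· ∈ D)), x ∈ D := by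
    intro F x hx
    obtain ⟨y, -, rfl⟩ := Finset.mem_map.1 hx
    exact y.2
  -- The families live in a compact product of intervals and converge along an ultrafilter finer
  -- than `atTop`. Each condition involves finitely many coordinates, so it passes to the limit.
  have hK : IsCompact (Set.univ.pi fun _ : X => Set.univ.pi fun _ : X => Set.Icc (0 : ℝ) 1) :=
    isCompact_univ_pi fun _ => isCompact_univ_pi fun _ => isCompact_Icc
  obtain ⟨l, -, hl⟩ := hK.ultrafilter_le_nhds (𝒰.map g) (by
    rw [le_principal_iff]
    change g ⁻¹' _ ∈ 𝒰
    refine Filter.univ_mem' fun F => ?_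
    exact fun x _ z _ => h01 _ (hFD F) x z)
  have hlim : ∀ x z, Tendsto (fun F => g F x z) 𝒰 (𝓝 (l x z)) := by
    intro x z
    have h1 : Tendsto g 𝒰 (𝓝 l) := hl
    exact tendsto_pi_nhds.1 (tendsto_pi_nhds.1 h1 x) z
  have hmem : ∀ x (hx : x ∈ D), ∀ᶠ F in (𝒰 : Filter (Finset D)),
      x ∈ F.map (Function.Embedding.subtype (· ∈ D)) := by
    intro x hx
    have h1 : ∀ᶠ F : Finset D in atTop, x ∈ F.map (Function.Embedding.subtype (· ∈ D)) := by
      filter_upwards [eventually_ge_atTop ({⟨x, hx⟩} : Finset D)] with F hF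
      exact Finset.mem_map.2 ⟨⟨x, hx⟩, hF (Finset.mem_singleton_self _), rfl⟩
    exact Ultrafilter.of_le _ h1
  refine ⟨l, fun x z => ?_, fun x z hxz => ?_, fun x hx => ⟨?_, fun y hy hxy => ?_⟩⟩
  · exact ge_of_tendsto' (hlim x z) fun F => (h01 _ (hFD F) x z).1
  · refine tendsto_nhds_unique (hlim x z) (tendsto_const_nhds.congr fun F => ?_)
    exact (hS _ (hFD F) x z hxz).symm
  · refine tendsto_nhds_unique (tendsto_finsetSum _ fun z _ => hlim x z)
      (tendsto_const_nhds.congr' ?_)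
    filter_upwards [hmem x hx] with F hxF
    exact (hF _ (hFD F) x hxF).1.symm
  · refine le_of_tendsto (tendsto_finsetSum _ fun z _ => ((hlim x z).sub (hlim y z)).abs) ?_
    filter_upwards [hmem x hx, hmem y hy] with F hxF hyF
    exact (hF _ (hFD F) x hxF).2 y hyF hxy

theorem hasPartialPropertyA_of_hasPartialONL [MeasurableSpace X] [BorelSpace X]
    {H : Type*} [NormedAddCommGroup H] [InnerProductSpace ℂ H] [CompleteSpace H] [Nontrivial H]
    (hX : IsSpace X) {V : Set (Ultrafilter X)} (hV : IsClosed V) (hVs : IsSaturated V)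
    (hONL : HasPartialONL X H V) : HasPartialPropertyA X V := by
  obtain ⟨c, hc, -, hONL⟩ := hONL
  refine hasPartialPropertyA_of_almostInvariant hX hV hVs fun R hR δ hδ => ?_
  obtain ⟨ε, hε, hε1, hεδ⟩ : ∃ ε : ℝ, 0 < ε ∧ ε < 1 ∧ 8 * ε ≤ δ ^ 2 := by
    refine ⟨min (1 / 2) (δ ^ 2 / 8), by positivity, ?_, ?_⟩
    · exact (min_le_left _ _).trans_lt (by norm_num)
    · linarith [min_le_right (1 / 2) (δ ^ 2 / 8)]
  have hκ : 1 < (1 - ε / 4) / (1 - ε / 2) := by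
    rw [one_lt_div (by linarith)]
    linarith
  -- Here `j` depends on `c` and `ε` only; it is fixed before localisation is invoked at propagation
  -- `2 ^ j * R`, which is possible because `c` is the same for all propagations.
  obtain ⟨j, hj⟩ := pow_unbounded_of_one_lt (1 / c) hκ
  have hj' : 1 < c * ((1 - ε / 4) / (1 - ε / 2)) ^ 2 ^ j := by
    have h1 := hj.trans_le (pow_le_pow_right₀ hκ.le (Nat.lt_two_pow_self (n := j)).le)
    rw [div_lt_iff₀ hc] at h1
    linarith
  obtain ⟨S, hS, D, hVD, hD⟩ := hONL ((2 ^ j : ℕ) * R) (by positivity)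
  refine ⟨S + 2 * ((2 ^ j : ℕ) * R), by positivity, D, hVD, ?_⟩
  refine exists_family_of_finite hX fun F hF => ?_
  obtain ⟨k, hk, hk'⟩ := Set.not_disjoint_iff.1
    (not_disjoint_of_localisation hX hc hR hS hε hε1 hj' hD hF)
  exact exists_family_of_kernel hX hε1 hδ.le hεδ hk hk'

end CoarseGeom

theorem mainTheorem10 {X : Type*} [MetricSpace X] [MeasurableSpace X] [BorelSpace X]
    (hX : CoarseGeom.IsSpace X)
    {H : Type*} [NormedAddCommGroup H] [InnerProductSpace ℂ H] [CompleteSpace H]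
    [TopologicalSpace.SeparableSpace H] (hH : ¬ FiniteDimensional ℂ H)
    (U : Set (Ultrafilter X)) (hUopen : IsOpen U)
    (hUinv : (CoarseGeom.coarseGroupoid X).IsInvariant U) :
    CoarseGeom.HasPartialPropertyA X (CoarseGeom.boundary X \ U) ↔
      CoarseGeom.HasPartialONL X H (CoarseGeom.boundary X \ U) := by
  have hV := CoarseGeom.isClosed_boundary_sdiff hUopen
  have hVs := hX.isSaturated_boundary_sdiff hUinv
  have : Nontrivial H := by
    by_contra h
    rw [not_nontrivial_iff_subsingleton] at h
    exact hH inferInstance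
  exact ⟨fun hA => CoarseGeom.hasPartialONL_of_almostInvariantFamilies hX
      (CoarseGeom.hasAlmostInvariantFamilies_of_hasPartialPropertyA hX hV hVs hA),
    CoarseGeom.hasPartialPropertyA_of_hasPartialONL hX hV hVs⟩
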